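/- **Theorem 3.1 (left representation, left-invariant Lagrangian).** Let $G$ be a smooth real Lie group modelled on a Banach space (for instance a finite-dimensional Lie group), with Lie algebra $\mathfrak g=T_1G$. Let $V$ be a real normed space with dual $V^*$, and let $\rho:G\to L(V,V)$ be a smooth representation on $V$ by bounded operators, written $gv=\rho(g)v$. The group $G$ acts on $V^*$ by $\langle ha,v\rangle=\langle a,h^{-1}v\rangle$. The Lie algebra $\mathfrak g$ acts on $V$ by $\xi v=(T_1\rho\cdot\xi)v$ and on $V^*$ by $\langle\xi a,v\rangle=-\langle a,\xi v\rangle$. Put $\langle\operatorname{ad}^*_\xi\mu,\eta\rangle=\langle\mu,[\xi,\eta]\rangle$ for $\mu\in\mathfrak g^*$. For $v\in V^{**}$ (which is $V$ if $V$ is finite dimensional) and $a\in V^*$, define $v\diamond a\in\mathfrak g^*$ by $\langle v\diamond a,\eta\rangle=-\langle\eta a,v\rangle$. Let $L:TG\times V^*\to\mathbb R$ be smooth and left $G$-invariant, that is, $L(hv_g,ha)=L(v_g,a)$ for all $h\in G$. Let $l:\mathfrak g\times V^*\to\mathbb R$ be the reduced Lagrangian, determined by $l(g^{-1}v_g,g^{-1}a)=L(v_g,a)$.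 Fix $a_0\in V^*$ and put $L_{a_0}(v_g)=L(v_g,a_0)$. Let $t_1<t_2$, let $g$ be a smooth curve in $G$ defined on an open set containing $[t_1,t_2]$, and put $\xi(t)=g(t)^{-1}\dot g(t)$ and $a(t)=g(t)^{-1}a_0$. Then the following are equivalent. (i) Hamilton's principle: for every smooth family $\gamma(\varepsilon,t)\in G$, defined near $\{0\}\times[t_1,t_2]$, with $\gamma(0,t)=g(t)$ for $t\in[t_1,t_2]$ and $\gamma(\varepsilon,t_i)=g(t_i)$ ($i=1,2$) for $\varepsilon$ near $0$, $$\frac{d}{d\varepsilon}\Big|_{\varepsilon=0}\int_{t_1}^{t_2}L_{a_0}\big(\gamma,\partial_t\gamma\big)\,dt=0 .$$ (ii) $g$ satisfies the Euler–Lagrange equations for $L_{a_0}$ on $[t_1,t_2]$: in every smooth chart of $G$, with $q(t)$ the coordinates of $g(t)$, $\frac{d}{dt}\frac{\partial L_{a_0}}{\partial\dot q}=\frac{\partial L_{a_0}}{\partial q}$. (iii) The constrained principle: for all smooth families $\Xi(\varepsilon,t)\in\mathfrak g$ and $A(\varepsilon,t)\in V^*$, defined near $\{0\}\times[t_1,t_2]$,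 with $\Xi(0,t)=\xi(t)$, $A(0,t)=a(t)$ and $$\partial_\varepsilon\Xi|_{\varepsilon=0}=\dot\eta+[\xi,\eta],\qquad \partial_\varepsilon A|_{\varepsilon=0}=-\eta a$$ on $[t_1,t_2]$ for some smooth curve $\eta(t)\in\mathfrak g$, defined near $[t_1,t_2]$, with $\eta(t_1)=\eta(t_2)=0$, one has $$\frac{d}{d\varepsilon}\Big|_{\varepsilon=0}\int_{t_1}^{t_2}l(\Xi,A)\,dt=0 .$$ (iv) The Euler–Poincaré equations hold on $[t_1,t_2]$ along $(\xi(t),a(t))$: $$\frac{d}{dt}\frac{\delta l}{\delta\xi}=\operatorname{ad}^*_\xi\frac{\delta l}{\delta\xi}+\frac{\delta l}{\delta a}\diamond a ,$$ where $\delta l/\delta\xi\in\mathfrak g^*$ and $\delta l/\delta a\in V^{**}$ are the partial derivatives of $l$. -/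

import Mathlib

open Set Filter Topology
open scoped Manifold ContDiff

noncomputable section

namespace EulerPoincare

/-! `G` is a real Lie group modelled on `E`, written with the model `𝓘(ℝ, E)`. The Lie algebra
`𝔤 = T₁G` is Mathlib's `GroupLieAlgebra 𝓘(ℝ, E) G`, whose underlying vector space is by definition
the model space `E`; its elements are typed as elements of `E`. The representation space is `V`
and `V* = StrongDual ℝ V`. -/

variable {E : Type*} [NormedAddCommGroup E] [NormedSpace ℝ E]
  {G : Type*} [TopologicalSpace G] [ChartedSpace E G] [Group G]
  {V : Type*} [NormedAddCommGroup V] [NormedSpace ℝ V]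

/-- The Lie bracket `[ξ, η]` of `𝔤 = T₁G` (bracket of left-invariant vector fields). -/
def bracket (G : Type*) [TopologicalSpace G] [ChartedSpace E G] [Group G] (ξ η : E) : E :=
  (⁅(show GroupLieAlgebra 𝓘(ℝ, E) G from ξ), (show GroupLieAlgebra 𝓘(ℝ, E) G from η)⁆ :
    GroupLieAlgebra 𝓘(ℝ, E) G)

/-- The functional `ad*_ξ μ : η ↦ ⟨μ, [ξ, η]⟩` on `𝔤`, for `μ ∈ 𝔤*`. -/
def coadjoint (G : Type*) [TopologicalSpace G] [ChartedSpace E G] [Group G] (ξ : E)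
    (μ : StrongDual ℝ E) : E → ℝ :=
  fun η => μ (bracket G ξ η)

/-- The velocity `(c(t), ċ(t)) ∈ TG` of a curve in `G`. -/
def velocity (c : ℝ → G) (t : ℝ) : TangentBundle 𝓘(ℝ, E) G :=
  ⟨c t, mfderiv 𝓘(ℝ, ℝ) 𝓘(ℝ, E) c t (1 : ℝ)⟩

/-- Left translation to the identity: `v_g ↦ g⁻¹ v_g ∈ 𝔤`. -/
def toLieAlgebra (v : TangentBundle 𝓘(ℝ, E) G) : E :=
  mfderiv 𝓘(ℝ, E) 𝓘(ℝ, E) (fun x : G => v.proj⁻¹ * x) v.proj v.snd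

/-- The lifted left action of `G` on `TG`: `(h, v_g) ↦ h v_g`. -/
def leftTangentAction (h : G) (v : TangentBundle 𝓘(ℝ, E) G) : TangentBundle 𝓘(ℝ, E) G :=
  tangentMap 𝓘(ℝ, E) 𝓘(ℝ, E) (fun x : G => h * x) v

/-- The left action of `G` on `V*`: the inverse of the transpose of the action on `V`. -/
def dualAction (ρ : G →* (V →L[ℝ] V)) (h : G) (a : StrongDual ℝ V) : StrongDual ℝ V :=
  a.comp (ρ h⁻¹)

/-- The induced action `ξ v` of `𝔤` on `V`, i.e. the derivative of `ρ` at the identity. -/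
def lieRep (ρ : G →* (V →L[ℝ] V)) : E →L[ℝ] (V →L[ℝ] V) :=
  mfderiv 𝓘(ℝ, E) 𝓘(ℝ, V →L[ℝ] V) (fun x : G => ρ x) 1

/-- The action `ξ a` of `𝔤` on `V*`: minus the dual of the action of `𝔤` on `V`. -/
def lieDualAction (ρ : G →* (V →L[ℝ] V)) (ξ : E) (a : StrongDual ℝ V) : StrongDual ℝ V :=
  -(a.comp (lieRep ρ ξ))

/-- The diamond operation `v ⋄ a ∈ 𝔤*`, given by `⟨v ⋄ a, η⟩ = -⟨η a, v⟩`. Functional derivatives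
with respect to `a ∈ V*` live in `V**`, so `v` ranges over `V**` (which is `V` when `V` is finite
dimensional or reflexive). -/
def diamond (ρ : G →* (V →L[ℝ] V)) (v : StrongDual ℝ (StrongDual ℝ V)) (a : StrongDual ℝ V) :
    StrongDual ℝ E :=
  v.comp ((ContinuousLinearMap.compL ℝ V V ℝ a).comp (lieRep ρ))

theorem diamond_apply (ρ : G →* (V →L[ℝ] V)) (v : StrongDual ℝ (StrongDual ℝ V))
    (a : StrongDual ℝ V) (η : E) : diamond ρ v a η = -(v (lieDualAction ρ η a)) := by
  simp [diamond, lieDualAction]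

/-- On `V ⊆ V**` the diamond is `v ⋄ a = ρ_v^* a`, where `ρ_v η = η v`. -/
theorem diamond_inclusion_apply (ρ : G →* (V →L[ℝ] V)) (v : V) (a : StrongDual ℝ V) (η : E) :
    diamond ρ (NormedSpace.inclusionInDoubleDual ℝ V v) a η = a (lieRep ρ η v) := by
  simp [diamond]

/-- Left `G`-invariance of `L : TG × V* → ℝ`. -/
def LeftInvariant (ρ : G →* (V →L[ℝ] V))
    (L : TangentBundle 𝓘(ℝ, E) G × StrongDual ℝ V → ℝ) : Prop :=
  ∀ (h : G) (v : TangentBundle 𝓘(ℝ, E) G) (a : StrongDual ℝ V),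
    L (leftTangentAction h v, dualAction ρ h a) = L (v, a)

/-- The reduced Lagrangian `l : 𝔤 × V* → ℝ`, the restriction of `L` to `T₁G × V*`. -/
def reduced (L : TangentBundle 𝓘(ℝ, E) G × StrongDual ℝ V → ℝ) (ξ : E) (a : StrongDual ℝ V) : ℝ :=
  L (⟨(1 : G), ξ⟩, a)

/-- The defining relation `l(g⁻¹ v_g, g⁻¹ a) = L(v_g, a)` of the reduced Lagrangian. -/
theorem reduced_eq {ρ : G →* (V →L[ℝ] V)} {L : TangentBundle 𝓘(ℝ, E) G × StrongDual ℝ V → ℝ}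
    (hL : LeftInvariant ρ L) (v : TangentBundle 𝓘(ℝ, E) G) (a : StrongDual ℝ V) :
    reduced L (toLieAlgebra v) (dualAction ρ v.proj⁻¹ a) = L (v, a) := by
  have aux : ∀ (x y : G) (w : E), x = y →
      (⟨x, w⟩ : TangentBundle 𝓘(ℝ, E) G) = ⟨y, w⟩ := by
    intro x y w h
    subst h
    rfl
  rw [← hL v.proj⁻¹ v a]
  exact congrArg (fun z => L (z, dualAction ρ v.proj⁻¹ a))
    (aux 1 (v.proj⁻¹ * v.proj) (toLieAlgebra v) (inv_mul_cancel _).symm)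

/-- `ξ(t) = g(t)⁻¹ ġ(t)`. -/
def bodyVelocity (g : ℝ → G) (t : ℝ) : E :=
  toLieAlgebra (velocity (E := E) g t)

/-- `a(t) = g(t)⁻¹ a₀`. -/
def advected (ρ : G →* (V →L[ℝ] V)) (a₀ : StrongDual ℝ V) (g : ℝ → G) (t : ℝ) : StrongDual ℝ V :=
  dualAction ρ (g t)⁻¹ a₀

/-! ### Hamilton's principle and the Euler–Lagrange equations of a Lagrangian on `TG` -/

/-- `γ(ε, t)` is a smooth variation, with fixed endpoints, of the curve `g` on `[t₁, t₂]`. It is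
defined for `(ε, t)` in some neighbourhood of `{0} × [t₁, t₂]`. -/
def IsVariation (E : Type*) [NormedAddCommGroup E] [NormedSpace ℝ E] {G : Type*}
    [TopologicalSpace G] [ChartedSpace E G] (t₁ t₂ : ℝ) (g : ℝ → G) (γ : ℝ → ℝ → G) : Prop :=
  (∃ U : Set (ℝ × ℝ), IsOpen U ∧ {(0 : ℝ)} ×ˢ Icc t₁ t₂ ⊆ U ∧
    ContMDiffOn 𝓘(ℝ, ℝ × ℝ) 𝓘(ℝ, E) ∞ (fun p : ℝ × ℝ => γ p.1 p.2) U) ∧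
  (∀ t ∈ Icc t₁ t₂, γ 0 t = g t) ∧
  (∀ᶠ ε in 𝓝 (0 : ℝ), γ ε t₁ = g t₁ ∧ γ ε t₂ = g t₂)

/-- Hamilton's principle `δ ∫ Λ(g, ġ) dt = 0` for all variations with fixed endpoints. -/
def HamiltonPrinciple (Λ : TangentBundle 𝓘(ℝ, E) G → ℝ) (t₁ t₂ : ℝ) (g : ℝ → G) : Prop :=
  ∀ γ : ℝ → ℝ → G, IsVariation E t₁ t₂ g γ →
    HasDerivAt (fun ε => ∫ t in t₁..t₂, Λ (velocity (γ ε) t)) 0 0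

/-- The Lagrangian `Λ` in the local coordinates `(q, q̇)` of the chart `e`. -/
def localLagrangian (Λ : TangentBundle 𝓘(ℝ, E) G → ℝ) (e : OpenPartialHomeomorph G E)
    (q w : E) : ℝ :=
  Λ ⟨e.symm q, mfderiv 𝓘(ℝ, E) 𝓘(ℝ, E) e.symm q w⟩

/-- The Euler–Lagrange equations `d/dt ∂Λ/∂q̇ = ∂Λ/∂q` along `g` on `[t₁, t₂]`, in every smooth
chart of `G`, with `q(t) = e(g(t))`. -/
def EulerLagrange (Λ : TangentBundle 𝓘(ℝ, E) G → ℝ) (t₁ t₂ : ℝ) (g : ℝ → G) : Prop :=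
  ∀ t ∈ Icc t₁ t₂, ∀ e ∈ IsManifold.maximalAtlas 𝓘(ℝ, E) ∞ G, g t ∈ e.source →
    HasDerivAt
      (fun s => fderiv ℝ (fun w => localLagrangian Λ e (e (g s)) w) (deriv (fun r => e (g r)) s))
      (fderiv ℝ (fun q => localLagrangian Λ e q (deriv (fun r => e (g r)) t)) (e (g t))) t

/-! ### The constrained principle and the Euler–Poincaré equations on `𝔤 × V*` -/

/-- `(Ξ(ε, t), A(ε, t))` is a smooth variation of `(ξ, a)` on `[t₁, t₂]` whose infinitesimal
variation is `δξ = η̇ + [ξ, η]`, `δa = -η a` for some smooth `η` vanishing at the endpoints. -/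
def IsConstrainedVariation (ρ : G →* (V →L[ℝ] V)) (t₁ t₂ : ℝ) (ξ : ℝ → E)
    (a : ℝ → StrongDual ℝ V) (Ξ : ℝ → ℝ → E) (A : ℝ → ℝ → StrongDual ℝ V) : Prop :=
  (∃ U : Set (ℝ × ℝ), IsOpen U ∧ {(0 : ℝ)} ×ˢ Icc t₁ t₂ ⊆ U ∧
    ContDiffOn ℝ ∞ (fun p : ℝ × ℝ => Ξ p.1 p.2) U ∧
    ContDiffOn ℝ ∞ (fun p : ℝ × ℝ => A p.1 p.2) U) ∧
  (∀ t ∈ Icc t₁ t₂, Ξ 0 t = ξ t ∧ A 0 t = a t) ∧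
  ∃ η : ℝ → E,
    (∃ W : Set ℝ, IsOpen W ∧ Icc t₁ t₂ ⊆ W ∧ ContDiffOn ℝ ∞ η W) ∧ η t₁ = 0 ∧ η t₂ = 0 ∧
    ∀ t ∈ Icc t₁ t₂,
      HasDerivAt (fun ε => Ξ ε t) (deriv η t + bracket G (ξ t) (η t)) 0 ∧
      HasDerivAt (fun ε => A ε t) (-(lieDualAction ρ (η t) (a t))) 0

/-- The constrained variational principle `δ ∫ l(ξ, a) dt = 0`. -/
def ConstrainedPrinciple (ρ : G →* (V →L[ℝ] V)) (l : E → StrongDual ℝ V → ℝ) (t₁ t₂ : ℝ)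
    (ξ : ℝ → E) (a : ℝ → StrongDual ℝ V) : Prop :=
  ∀ (Ξ : ℝ → ℝ → E) (A : ℝ → ℝ → StrongDual ℝ V), IsConstrainedVariation ρ t₁ t₂ ξ a Ξ A →
    HasDerivAt (fun ε => ∫ t in t₁..t₂, l (Ξ ε t) (A ε t)) 0 0

/-- `δl/δξ ∈ 𝔤*`. -/
def derivXi (l : E → StrongDual ℝ V → ℝ) (ξ : E) (a : StrongDual ℝ V) : StrongDual ℝ E :=
  fderiv ℝ (fun ζ => l ζ a) ξ

/-- `δl/δa ∈ V**`. -/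
def derivA (l : E → StrongDual ℝ V → ℝ) (ξ : E) (a : StrongDual ℝ V) :
    StrongDual ℝ (StrongDual ℝ V) :=
  fderiv ℝ (fun b => l ξ b) a

/-- The Euler–Poincaré equations `d/dt δl/δξ = ad*_ξ δl/δξ + δl/δa ⋄ a` on `[t₁, t₂]`: the curve
`δl/δξ` in `𝔤*` is differentiable and its derivative is the functional on the right. -/
def EulerPoincareEquations (ρ : G →* (V →L[ℝ] V)) (l : E → StrongDual ℝ V → ℝ) (t₁ t₂ : ℝ)
    (ξ : ℝ → E) (a : ℝ → StrongDual ℝ V) : Prop :=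
  ∀ t ∈ Icc t₁ t₂, ∃ μ' : StrongDual ℝ E,
    HasDerivAt (fun s => derivXi l (ξ s) (a s)) μ' t ∧
    ∀ η : E, μ' η = coadjoint G (ξ t) (derivXi l (ξ t) (a t)) η +
      diamond ρ (derivA l (ξ t) (a t)) (a t) η

end EulerPoincare

end

/-! All four conditions are compared with the vanishing on [t₁, t₂] of one curve in 𝔤*, the defect R
= d/dt δl/δξ − ad*_ξ δl/δξ − δl/δa ⋄ a (`residual`). The bracket of 𝔤 is bounded
(`exists_bracket_eq`), so R(t) is a continuous functional, and (iv) says that R = 0.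

In a chart, write K(q) : E → 𝔤 for the left Maurer–Cartan form (`leftForm`). It is invertible, and
the body velocity of a curve is K(q) q̇. Noncommutativity enters through the Maurer–Cartan equation
DK(q)(w) v − DK(q)(v) w = [K v, K w] (`fderiv_leftForm_sub`), which is used in two ways.

Applied to the two partial derivatives of a family γ(ε, t), it gives ∂_ε ξ = ∂_t η + [ξ, η] with η =
γ⁻¹ ∂_ε γ (`hasDerivAt_bodyVelocity_family`). Differentiating the representation gives ∂_ε a = −η a.
Hence a variation of g induces a constrained variation of (ξ, a), and by invariance the two actions
agree: (iii) implies (i).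

Applied to the local Lagrangian l(K(q) q̇, a(q)), it gives d/dt ∂L/∂q̇ − ∂L/∂q = R ∘ K(q)
(`hasDerivAt_fiberDerivative`). Since K(q) is invertible, (ii) is equivalent to (iv).

Integration by parts turns the first variation of ∫ l into −∫ ⟨R, η⟩ dt
(`hasDerivAt_integral_reduced`), so (iv) implies (iii). Conversely, each η = φ η₀ with φ scalar and
zero at the endpoints comes from a variation of g (`exists_isVariation`), and the fundamental lemma
applied to ⟨R, η₀⟩ for each η₀ shows that (i) implies (iv). -/

namespace EulerPoincare

/-! ### The left Maurer–Cartan form in a chart and its structure equation. -/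

section LeftForm

variable {E : Type*} [NormedAddCommGroup E] [NormedSpace ℝ E]
  {G : Type*} [TopologicalSpace G] [ChartedSpace E G] [Group G]

/-- The left Maurer–Cartan form in the chart `e`: the derivative at `q` of left translation by the
inverse of `e.symm q`, read in the chart `e` and in the preferred chart at `1`. -/
noncomputable def leftForm (e : OpenPartialHomeomorph G E) (q : E) : E →L[ℝ] E :=
  fderiv ℝ (fun q' => chartAt E (1 : G) ((e.symm q)⁻¹ * e.symm q')) q

variable [LieGroup 𝓘(ℝ, E) ∞ G]

variable (E G) in
theorem isManifold_infty : IsManifold 𝓘(ℝ, E) ∞ G :=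
  (inferInstance : LieGroup 𝓘(ℝ, E) ∞ G).toContMDiffMul.toIsManifold

variable (E G) in
theorem isManifold_one : IsManifold 𝓘(ℝ, E) 1 G :=
  have := isManifold_infty E G
  IsManifold.of_le (n := ∞) (by simp)

theorem hasMFDerivAt_chartAt_self (x : G) :
    HasMFDerivAt 𝓘(ℝ, E) 𝓘(ℝ, E) (chartAt E x) x (ContinuousLinearMap.id ℝ E) := by
  have := isManifold_one E G
  have h := (mdifferentiableAt_atlas (I := 𝓘(ℝ, E)) (chart_mem_atlas E x)
    (mem_chart_source E x)).hasMFDerivAt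
  have h2 : (tangentCoordChange 𝓘(ℝ, E) x x x : E →L[ℝ] E) = ContinuousLinearMap.id ℝ E :=
    ContinuousLinearMap.ext fun v => tangentCoordChange_self (I := 𝓘(ℝ, E)) (by simp)
  rw [mfderiv_chartAt_eq_tangentCoordChange (mem_chart_source E x)] at h
  exact h2 ▸ h

theorem mdifferentiable_mul_left (x : G) : MDifferentiable 𝓘(ℝ, E) 𝓘(ℝ, E) (fun y : G => x * y) :=
  (contMDiff_mul_left (I := 𝓘(ℝ, E)) (n := ∞) (a := x)).mdifferentiable (by simp)

omit [Group G] [LieGroup 𝓘(ℝ, E) ∞ G] in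
theorem mdifferentiableAt_symm_of_mem_maximalAtlas {e : OpenPartialHomeomorph G E}
    (he : e ∈ IsManifold.maximalAtlas 𝓘(ℝ, E) ∞ G) {q : E} (hq : q ∈ e.target) :
    MDifferentiableAt 𝓘(ℝ, E) 𝓘(ℝ, E) e.symm q :=
  (contMDiffAt_symm_of_mem_maximalAtlas he hq).mdifferentiableAt (by simp)

/-- The preferred chart at 1 has derivative the identity at 1, so reading the translated vector in
that chart does not change it. -/
theorem toLieAlgebra_mfderiv_symm {e : OpenPartialHomeomorph G E}
    (he : e ∈ IsManifold.maximalAtlas 𝓘(ℝ, E) ∞ G) {q : E} (hq : q ∈ e.target) (w : E) :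
    toLieAlgebra (⟨e.symm q, mfderiv 𝓘(ℝ, E) 𝓘(ℝ, E) e.symm q w⟩ : TangentBundle 𝓘(ℝ, E) G) =
      leftForm e q w := by
  have h1 := (mdifferentiableAt_symm_of_mem_maximalAtlas he hq).hasMFDerivAt
  have h2 := ((mdifferentiable_mul_left (E := E) (e.symm q)⁻¹) (e.symm q)).hasMFDerivAt
  have h3 : HasMFDerivAt 𝓘(ℝ, E) 𝓘(ℝ, E) (chartAt E (1 : G)) ((e.symm q)⁻¹ * e.symm q)
      (ContinuousLinearMap.id ℝ E) := by
    rw [inv_mul_cancel]; exact hasMFDerivAt_chartAt_self (1 : G)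
  have h := (HasMFDerivAt.comp (I' := 𝓘(ℝ, E)) q h3
    (HasMFDerivAt.comp (I' := 𝓘(ℝ, E)) q h2 h1)).mfderiv
  rw [mfderiv_eq_fderiv] at h
  exact (congrArg (fun T : E →L[ℝ] E => T w) h).symm

/-- In `leftForm` the translating point and the base point of the derivative are the same q.
Smoothness in q therefore needs joint smoothness in both variables at the diagonal. -/
theorem contDiffAt_chart_inv_mul {e : OpenPartialHomeomorph G E}
    (he : e ∈ IsManifold.maximalAtlas 𝓘(ℝ, E) ∞ G) {q : E} (hq : q ∈ e.target) :
    ContDiffAt ℝ ∞ (fun p : E × E => chartAt E (1 : G) ((e.symm p.1)⁻¹ * e.symm p.2)) (q, q) := by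
  have := isManifold_infty E G
  rw [← contMDiffAt_iff_contDiffAt]
  have hs := contMDiffAt_symm_of_mem_maximalAtlas he hq
  have h1 : ContMDiffAt 𝓘(ℝ, E × E) 𝓘(ℝ, E) ∞ (fun p : E × E => e.symm p.1) (q, q) :=
    ContMDiffAt.comp (I' := 𝓘(ℝ, E)) (q, q) (g := e.symm) (f := Prod.fst) hs
      contDiff_fst.contMDiff.contMDiffAt
  have h2 : ContMDiffAt 𝓘(ℝ, E × E) 𝓘(ℝ, E) ∞ (fun p : E × E => e.symm p.2) (q, q) :=
    ContMDiffAt.comp (I' := 𝓘(ℝ, E)) (q, q) (g := e.symm) (f := Prod.snd) hs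
      contDiff_snd.contMDiff.contMDiffAt
  have h3 : ContMDiffAt 𝓘(ℝ, E) 𝓘(ℝ, E) ∞ (chartAt E (1 : G)) ((e.symm q)⁻¹ * e.symm q) := by
    rw [inv_mul_cancel]
    exact contMDiffAt_of_mem_maximalAtlas (IsManifold.chart_mem_maximalAtlas _)
      (mem_chart_source E 1)
  exact ContMDiffAt.comp (I' := 𝓘(ℝ, E)) (q, q) (g := chartAt E (1 : G))
    (f := fun p : E × E => (e.symm p.1)⁻¹ * e.symm p.2) h3 (h1.inv.mul h2)

theorem contDiffAt_leftForm {e : OpenPartialHomeomorph G E}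
    (he : e ∈ IsManifold.maximalAtlas 𝓘(ℝ, E) ∞ G) {q : E} (hq : q ∈ e.target) :
    ContDiffAt ℝ ∞ (leftForm e) q :=
  ContDiffAt.fderiv (f := fun q q' => chartAt E (1 : G) ((e.symm q)⁻¹ * e.symm q'))
    (g := fun q => q) (n := ∞) (contDiffAt_chart_inv_mul he hq) contDiffAt_id (by simp)

/-- The values of left-invariant vector fields in a chart invert the left Maurer–Cartan form. -/
theorem leftForm_eq_inverse {e : OpenPartialHomeomorph G E}
    (he : e ∈ IsManifold.maximalAtlas 𝓘(ℝ, E) ∞ G) {q : E} (hq : q ∈ e.target) :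
    ∃ A : E ≃L[ℝ] E, leftForm e q = A ∧
      ∀ v : E, VectorField.mpullback 𝓘(ℝ, E) 𝓘(ℝ, E) e.symm
        (mulInvariantVectorField (I := 𝓘(ℝ, E)) (G := G) v) q = A.symm v := by
  have hT := mdifferentiable_mul_left (E := E) (e.symm q)⁻¹
  have hS := mdifferentiable_mul_left (E := E) (e.symm q)
  obtain ⟨D, hD⟩ : ∃ D : E →L[ℝ] E, D = mfderiv 𝓘(ℝ, E) 𝓘(ℝ, E) e.symm q := ⟨_, rfl⟩
  obtain ⟨F, hF⟩ : ∃ F : E →L[ℝ] E, F = mfderiv 𝓘(ℝ, E) 𝓘(ℝ, E) e (e.symm q) := ⟨_, rfl⟩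
  obtain ⟨T, hT'⟩ : ∃ T : E →L[ℝ] E, T = mfderiv 𝓘(ℝ, E) 𝓘(ℝ, E)
    (fun x : G => (e.symm q)⁻¹ * x) (e.symm q) := ⟨_, rfl⟩
  obtain ⟨S, hS'⟩ : ∃ S : E →L[ℝ] E, S = mfderiv 𝓘(ℝ, E) 𝓘(ℝ, E)
    (fun x : G => e.symm q * x) 1 := ⟨_, rfl⟩
  have hmd : e.MDifferentiable 𝓘(ℝ, E) 𝓘(ℝ, E) :=
    ⟨(contMDiffOn_of_mem_maximalAtlas he).mdifferentiableOn (by simp),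
      (contMDiffOn_symm_of_mem_maximalAtlas he).mdifferentiableOn (by simp)⟩
  have hFD : ∀ v, F (D v) = v := fun v => by
    rw [hF, hD]
    exact congrArg (fun T : E →L[ℝ] E => T v) (hmd.comp_symm_deriv hq)
  have hDF : ∀ v, D (F v) = v := fun v => by
    have h := congrArg (fun T : E →L[ℝ] E => T v) (hmd.symm_comp_deriv (e.map_target hq))
    rw [e.right_inv hq] at h
    rw [hF, hD]
    exact h
  have hTS : ∀ v, T (S v) = v := fun v => by
    have hT1 := (hT (e.symm q * 1)).hasMFDerivAt
    have h := (HasMFDerivAt.comp (I' := 𝓘(ℝ, E)) 1 hT1 (hS 1).hasMFDerivAt).mfderiv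
    have hid : (fun y : G => (e.symm q)⁻¹ * y) ∘ (fun y : G => e.symm q * y) = id := by
      ext y; simp
    rw [hid, mfderiv_id, mul_one] at h
    rw [hT', hS']
    exact (congrArg (fun T : E →L[ℝ] E => T v) h).symm
  have hST : ∀ v, S (T v) = v := fun v => by
    have hS1 := (hS ((e.symm q)⁻¹ * e.symm q)).hasMFDerivAt
    have h := (HasMFDerivAt.comp (I' := 𝓘(ℝ, E)) (e.symm q) hS1
      (hT (e.symm q)).hasMFDerivAt).mfderiv
    have hid : (fun y : G => e.symm q * y) ∘ (fun y : G => (e.symm q)⁻¹ * y) = id := by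
      ext y; simp
    rw [hid, mfderiv_id, inv_mul_cancel] at h
    rw [hT', hS']
    exact (congrArg (fun T : E →L[ℝ] E => T v) h).symm
  have hL : ∀ v, leftForm e q v = T (D v) := fun v => by
    rw [← toLieAlgebra_mfderiv_symm he hq, hT', hD]; rfl
  -- T and S are translation to and from the identity, D and F the derivatives of the inverse chart
  -- and of the chart. So K = T D has inverse F S, and F S v is the left-invariant field of v read
  -- in the chart.
  refine ⟨ContinuousLinearEquiv.equivOfInverse (T.comp D) (F.comp S)
    (fun v => by simp [hST, hFD]) (fun v => by simp [hDF, hTS]), ?_, fun v => ?_⟩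
  · ext v; exact hL v
  · have : D.inverse = F := ContinuousLinearMap.inverse_eq
      (ContinuousLinearMap.ext hDF) (ContinuousLinearMap.ext hFD)
    change (ContinuousLinearMap.inverse (M := E) (M₂ := E)
      (mfderiv 𝓘(ℝ, E) 𝓘(ℝ, E) e.symm q) : E →L[ℝ] E)
      (mfderiv 𝓘(ℝ, E) 𝓘(ℝ, E) (fun x : G => e.symm q * x) 1 v) = F (S v)
    rw [← this, hD, hS']
    rfl

/-- The Maurer–Cartan equation. -/
theorem fderiv_leftForm_sub [CompleteSpace E] {e : OpenPartialHomeomorph G E}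
    (he : e ∈ IsManifold.maximalAtlas 𝓘(ℝ, E) ∞ G) {q : E} (hq : q ∈ e.target) (v w : E) :
    fderiv ℝ (leftForm e) q w v - fderiv ℝ (leftForm e) q v w =
      bracket G (leftForm e q v) (leftForm e q w) := by
  have : LieGroup 𝓘(ℝ, E) (minSmoothness ℝ 3) G := by
    rw [minSmoothness_of_isRCLikeNormedField]
    exact LieGroup.of_le (n := ∞) (WithTop.coe_le_coe.2 le_top)
  have := isManifold_infty E G
  have : IsManifold 𝓘(ℝ, E) (minSmoothness ℝ 3) G := by
    rw [minSmoothness_of_isRCLikeNormedField]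
    exact IsManifold.of_le (n := ∞) (WithTop.coe_le_coe.2 le_top)
  obtain ⟨A, hA, hAinv⟩ := leftForm_eq_inverse he hq
  set x : E := leftForm e q v with hx
  set y : E := leftForm e q w with hy
  -- Pullback by the inverse chart commutes with brackets, and left-invariant fields pull back to u
  -- ↦ K(u)⁻¹ z. The claim becomes a computation with ordinary brackets of vector fields on E.
  have key := VectorField.mpullback_mlieBracket (n := ∞)
    (mdifferentiableAt_mulInvariantVectorField (I := 𝓘(ℝ, E)) (G := G) x (g := e.symm q))
    (mdifferentiableAt_mulInvariantVectorField (I := 𝓘(ℝ, E)) (G := G) y (g := e.symm q))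
    (contMDiffAt_symm_of_mem_maximalAtlas he hq) (by
      rw [minSmoothness_of_isRCLikeNormedField]; exact WithTop.coe_le_coe.2 le_top)
  rw [← mulInvariantVector_mlieBracket (I := 𝓘(ℝ, E)) (G := G) x y] at key
  have hlie : ∀ Z W : (x : E) → TangentSpace 𝓘(ℝ, E) x, VectorField.mlieBracket 𝓘(ℝ, E) Z W q =
      fderiv ℝ (F := E) W q (Z q) - fderiv ℝ (F := E) Z q (W q) := fun Z W => by
    rw [← VectorField.mlieBracketWithin_univ, VectorField.mlieBracketWithin_eq_lieBracketWithin]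
    exact congrFun (VectorField.lieBracketWithin_univ (V := Z) (W := W)) q
  have hinvt : ∀ z : E, (fun u => (leftForm e u).inverse z) =ᶠ[𝓝 q]
      VectorField.mpullback 𝓘(ℝ, E) 𝓘(ℝ, E) e.symm
        (mulInvariantVectorField (I := 𝓘(ℝ, E)) (G := G) z) := fun z => by
    filter_upwards [e.open_target.mem_nhds hq] with u hu
    obtain ⟨B, hB, hBinv⟩ := leftForm_eq_inverse he hu
    rw [hBinv z, hB, ContinuousLinearMap.inverse_equiv]
    rfl
  have hdiff : ∀ z : E, DifferentiableAt ℝ (fun u => (leftForm e u).inverse z) q := fun z => by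
    have h1 : ContDiffAt ℝ ∞ (fun u => (leftForm e u).inverse) q := by
      refine ContDiffAt.comp q (g := ContinuousLinearMap.inverse) ?_ (contDiffAt_leftForm he hq)
      rw [hA]
      exact contDiffAt_map_inverse A
    exact (h1.differentiableAt (by simp)).clm_apply (differentiableAt_const z)
  have hK := (contDiffAt_leftForm he hq).differentiableAt (by simp)
  -- Differentiating K(u) K(u)⁻¹ z = z trades the derivative of the inverse for that of K.
  have hD : ∀ z u : E, leftForm e q (fderiv ℝ (fun u => (leftForm e u).inverse z) q u) =
      - fderiv ℝ (leftForm e) q u (A.symm z) := fun z u => by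
    have hc : (fun u => leftForm e u ((leftForm e u).inverse z)) =ᶠ[𝓝 q] fun _ => z := by
      filter_upwards [e.open_target.mem_nhds hq] with u hu
      obtain ⟨B, hB, -⟩ := leftForm_eq_inverse he hu
      simp [hB, ContinuousLinearMap.inverse_equiv]
    have h1 := hc.fderiv_eq (𝕜 := ℝ)
    rw [fderiv_clm_apply hK (hdiff z), fderiv_fun_const] at h1
    have h2 := DFunLike.congr_fun h1 u
    have h3 : (leftForm e q).inverse z = A.symm z := by
      rw [hA, ContinuousLinearMap.inverse_equiv]; rfl
    simp only [add_apply, ContinuousLinearMap.comp_apply,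
      ContinuousLinearMap.flip_apply, Pi.zero_apply, zero_apply, h3] at h2
    exact eq_neg_of_add_eq_zero_left h2
  have hXq : A.symm x = v := by rw [hx, hA]; simp
  have hYq : A.symm y = w := by rw [hy, hA]; simp
  have key2 : A.symm (bracket G x y) =
      fderiv ℝ (fun u => (leftForm e u).inverse y) q v -
        fderiv ℝ (fun u => (leftForm e u).inverse x) q w := by
    refine (hAinv (bracket G x y)).symm.trans (key.trans ((hlie _ _).trans ?_))
    rw [(hinvt x).fderiv_eq, (hinvt y).fderiv_eq, ← hXq, ← hYq, ← hAinv x, ← hAinv y]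
  have key3 := congrArg (leftForm e q) key2
  rw [map_sub, hD, hD, hXq, hYq] at key3
  rw [hA] at key3
  simp only [ContinuousLinearEquiv.coe_coe, ContinuousLinearEquiv.apply_symm_apply] at key3
  rw [key3]
  abel

end LeftForm

/-! ### Body velocity, advected parameter and Lagrangian in a chart. -/

section Curves

variable {E : Type*} [NormedAddCommGroup E] [NormedSpace ℝ E]
  {G : Type*} [TopologicalSpace G] [ChartedSpace E G] [Group G] [LieGroup 𝓘(ℝ, E) ∞ G]
  {V : Type*} [NormedAddCommGroup V] [NormedSpace ℝ V]

theorem bodyVelocity_eq_leftForm {e : OpenPartialHomeomorph G E}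
    (he : e ∈ IsManifold.maximalAtlas 𝓘(ℝ, E) ∞ G) {c : ℝ → G} {t : ℝ}
    (hc : MDifferentiableAt 𝓘(ℝ, ℝ) 𝓘(ℝ, E) c t) (het : c t ∈ e.source) :
    bodyVelocity c t = leftForm e (e (c t)) (deriv (fun s => e (c s)) t) := by
  have hq := e.map_source het
  have hs := mdifferentiableAt_symm_of_mem_maximalAtlas he hq
  have he' : MDifferentiableAt 𝓘(ℝ, E) 𝓘(ℝ, E) e (c t) :=
    (contMDiffAt_of_mem_maximalAtlas he het).mdifferentiableAt (by simp)
  have hec : HasMFDerivAt 𝓘(ℝ, ℝ) 𝓘(ℝ, E) (e ∘ c) t (mfderiv 𝓘(ℝ, ℝ) 𝓘(ℝ, E) (e ∘ c) t) :=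
    (MDifferentiableAt.comp (I' := 𝓘(ℝ, E)) t he' hc).hasMFDerivAt
  have h := (HasMFDerivAt.comp (I' := 𝓘(ℝ, E)) t hs.hasMFDerivAt hec).congr_of_eventuallyEq
    (f₁ := c) (by
      filter_upwards [hc.continuousAt.preimage_mem_nhds (e.open_source.mem_nhds het)] with s hs
      exact (e.left_inv hs).symm)
  have h1 : deriv (fun s => e (c s)) t = mfderiv 𝓘(ℝ, ℝ) 𝓘(ℝ, E) (e ∘ c) t (1 : ℝ) := by
    rw [mfderiv_eq_fderiv]; exact fderiv_apply_one_eq_deriv.symm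
  have aux : ∀ (x y : G) (v w : E), x = y → v = w →
      (⟨x, v⟩ : TangentBundle 𝓘(ℝ, E) G) = ⟨y, w⟩ := by
    rintro x _ v _ rfl rfl
    rfl
  refine Eq.trans ?_ (toLieAlgebra_mfderiv_symm he hq _)
  refine congrArg toLieAlgebra (aux _ _ _ _ (e.left_inv het).symm ?_)
  refine (congrArg (fun T : ℝ →L[ℝ] E => T 1) h.mfderiv).trans ?_
  exact congrArg (mfderiv 𝓘(ℝ, E) 𝓘(ℝ, E) e.symm (e (c t)) : E →L[ℝ] E) h1.symm

/-- The derivative of a representation at any group element. -/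
theorem hasMFDerivAt_rep {ρ : G →* (V →L[ℝ] V)}
    (hρ : ContMDiff 𝓘(ℝ, E) 𝓘(ℝ, V →L[ℝ] V) ∞ (fun x : G => ρ x)) (x : G) :
    HasMFDerivAt 𝓘(ℝ, E) 𝓘(ℝ, V →L[ℝ] V) (fun x : G => ρ x) x
      ((ContinuousLinearMap.compL ℝ V V V (ρ x)).comp ((lieRep (E := E) ρ).comp
        (mfderiv 𝓘(ℝ, E) 𝓘(ℝ, E) (fun y : G => x⁻¹ * y) x))) := by
  have h1 := ((mdifferentiable_mul_left (E := E) x⁻¹) x).hasMFDerivAt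
  have h2 : HasMFDerivAt 𝓘(ℝ, E) 𝓘(ℝ, V →L[ℝ] V) (fun x : G => ρ x) (x⁻¹ * x)
      (lieRep (E := E) ρ) := by
    rw [inv_mul_cancel]
    exact ((hρ 1).mdifferentiableAt (by simp)).hasMFDerivAt
  have h3 := (ContinuousLinearMap.compL ℝ V V V (ρ x)).hasMFDerivAt (x := ρ (x⁻¹ * x))
  have h := HasMFDerivAt.comp (I' := 𝓘(ℝ, V →L[ℝ] V)) x h3
    (HasMFDerivAt.comp (I' := 𝓘(ℝ, E)) x h2 h1)
  refine h.congr_of_eventuallyEq (.of_forall fun y => ?_)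
  -- The homomorphism property reduces the derivative at x to the derivative at the identity.
  change ρ y = ρ x * ρ (x⁻¹ * y)
  rw [← map_mul, mul_inv_cancel_left]

/-- The two inverses cancel and the advected parameter is a₀ ∘ ρ(c(t)), whose derivative is a ∘
ρ'(ξ) = −ξ a. It is applied below in the ε direction of a family, where ξ becomes η. -/
theorem hasDerivAt_advected {ρ : G →* (V →L[ℝ] V)}
    (hρ : ContMDiff 𝓘(ℝ, E) 𝓘(ℝ, V →L[ℝ] V) ∞ (fun x : G => ρ x)) (a₀ : StrongDual ℝ V)
    {c : ℝ → G} {t : ℝ} (hc : MDifferentiableAt 𝓘(ℝ, ℝ) 𝓘(ℝ, E) c t) :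
    HasDerivAt (advected ρ a₀ c)
      (-lieDualAction ρ (bodyVelocity (E := E) c t) (advected ρ a₀ c t)) t := by
  obtain ⟨T, hT⟩ : ∃ T : E →L[ℝ] E, T = mfderiv 𝓘(ℝ, E) 𝓘(ℝ, E) (fun y : G => (c t)⁻¹ * y) (c t) :=
    ⟨_, rfl⟩
  obtain ⟨C, hC⟩ : ∃ C : ℝ →L[ℝ] E, C = mfderiv 𝓘(ℝ, ℝ) 𝓘(ℝ, E) c t := ⟨_, rfl⟩
  have hv : bodyVelocity c t = T (C 1) := by rw [hT, hC]; rfl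
  have h : HasFDerivAt (fun s => ρ (c s))
      (((ContinuousLinearMap.compL ℝ V V V (ρ (c t))).comp ((lieRep (E := E) ρ).comp T)).comp C)
      t := by
    rw [hT, hC]
    exact (HasMFDerivAt.comp (I' := 𝓘(ℝ, E)) t (hasMFDerivAt_rep hρ (c t))
      hc.hasMFDerivAt).hasFDerivAt
  have h2 : HasDerivAt (fun s => a₀.comp (ρ (c s))) _ t :=
    (ContinuousLinearMap.compL ℝ V V ℝ a₀).hasFDerivAt.comp_hasDerivAt t h.hasDerivAt
  have hfun : advected ρ a₀ c = fun s => a₀.comp (ρ (c s)) := by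
    funext s; simp [advected, dualAction]
  rw [hfun, hv]
  refine h2.congr_deriv ?_
  ext v
  simp [lieDualAction]

/-- This derivative in position is the source of the diamond term in ∂L/∂q. -/
theorem hasFDerivAt_dualAction_symm {ρ : G →* (V →L[ℝ] V)}
    (hρ : ContMDiff 𝓘(ℝ, E) 𝓘(ℝ, V →L[ℝ] V) ∞ (fun x : G => ρ x)) (a₀ : StrongDual ℝ V)
    {e : OpenPartialHomeomorph G E} (he : e ∈ IsManifold.maximalAtlas 𝓘(ℝ, E) ∞ G) {q : E}
    (hq : q ∈ e.target) :
    HasFDerivAt (fun q => dualAction ρ (e.symm q)⁻¹ a₀)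
      ((ContinuousLinearMap.compL ℝ V V ℝ (dualAction ρ (e.symm q)⁻¹ a₀)).comp
        ((lieRep ρ).comp (leftForm e q))) q := by
  obtain ⟨T, hT⟩ : ∃ T : E →L[ℝ] E, T = mfderiv 𝓘(ℝ, E) 𝓘(ℝ, E)
    (fun y : G => (e.symm q)⁻¹ * y) (e.symm q) := ⟨_, rfl⟩
  obtain ⟨C, hC⟩ : ∃ C : E →L[ℝ] E, C = mfderiv 𝓘(ℝ, E) 𝓘(ℝ, E) e.symm q := ⟨_, rfl⟩
  have hv : leftForm e q = T.comp C := by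
    ext w; rw [← toLieAlgebra_mfderiv_symm he hq w, hT, hC]; rfl
  have h : HasFDerivAt (fun q => ρ (e.symm q))
      (((ContinuousLinearMap.compL ℝ V V V (ρ (e.symm q))).comp ((lieRep (E := E) ρ).comp T)).comp
        C) q := by
    rw [hT, hC]
    exact (HasMFDerivAt.comp (I' := 𝓘(ℝ, E)) q (hasMFDerivAt_rep hρ (e.symm q))
      (mdifferentiableAt_symm_of_mem_maximalAtlas he hq).hasMFDerivAt).hasFDerivAt
  have h2 : HasFDerivAt (fun q => a₀.comp (ρ (e.symm q))) _ q :=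
    (ContinuousLinearMap.compL ℝ V V ℝ a₀).hasFDerivAt.comp q h
  simp only [dualAction, inv_inv, hv]
  refine h2.congr_fderiv ?_
  ext w v
  simp

theorem contDiff_reduced {L : TangentBundle 𝓘(ℝ, E) G × StrongDual ℝ V → ℝ}
    (hL : ContMDiff (𝓘(ℝ, E).tangent.prod 𝓘(ℝ, StrongDual ℝ V)) 𝓘(ℝ, ℝ) ∞ L) :
    ContDiff ℝ ∞ (fun p : E × StrongDual ℝ V => reduced L p.1 p.2) := by
  have := isManifold_infty E G
  have := isManifold_one E G
  have h1 : ContMDiff 𝓘(ℝ, E) 𝓘(ℝ, E).tangent ∞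
      (fun ξ : E => (⟨1, ξ⟩ : TangentBundle 𝓘(ℝ, E) G)) := fun ξ₀ => by
    refine Bundle.contMDiffAt_totalSpace.2 ⟨contMDiffAt_const, ?_⟩
    refine contMDiffAt_id.congr_of_eventuallyEq (.of_forall fun ξ => ?_)
    exact tangentCoordChange_self (I := 𝓘(ℝ, E)) (x := (1 : G)) (z := 1) (v := ξ) (by simp)
  rw [← contMDiff_iff_contDiff]
  refine hL.comp ((h1.comp contDiff_fst.contMDiff).prodMk contDiff_snd.contMDiff)

/-- Translating to the identity leaves q only in K(q) and in the translated parameter. -/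
theorem localLagrangian_eq {ρ : G →* (V →L[ℝ] V)}
    {L : TangentBundle 𝓘(ℝ, E) G × StrongDual ℝ V → ℝ} (hinv : LeftInvariant ρ L)
    (a₀ : StrongDual ℝ V) {e : OpenPartialHomeomorph G E}
    (he : e ∈ IsManifold.maximalAtlas 𝓘(ℝ, E) ∞ G) {q : E} (hq : q ∈ e.target) (w : E) :
    localLagrangian (fun v => L (v, a₀)) e q w =
      reduced L (leftForm e q w) (dualAction ρ (e.symm q)⁻¹ a₀) := by
  rw [← toLieAlgebra_mfderiv_symm he hq]
  exact (reduced_eq hinv _ a₀).symm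

end Curves

/-! ### Two-parameter families and the variation of the body velocity. -/

section Families

variable {E : Type*} [NormedAddCommGroup E] [NormedSpace ℝ E]

theorem hasDerivAt_partial_right {u : ℝ × ℝ → E} {p : ℝ × ℝ} (hu : DifferentiableAt ℝ u p) :
    HasDerivAt (fun t => u (p.1, t)) (fderiv ℝ u p (0, 1)) p.2 := by
  have h : HasDerivAt (fun t : ℝ => (p.1, t)) ((0 : ℝ), (1 : ℝ)) p.2 :=
    (hasDerivAt_const p.2 p.1).prodMk (hasDerivAt_id p.2)
  exact hu.hasFDerivAt.comp_hasDerivAt p.2 h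

theorem hasDerivAt_partial_left {u : ℝ × ℝ → E} {p : ℝ × ℝ} (hu : DifferentiableAt ℝ u p) :
    HasDerivAt (fun ε => u (ε, p.2)) (fderiv ℝ u p (1, 0)) p.1 := by
  have h : HasDerivAt (fun ε : ℝ => (ε, p.2)) ((1 : ℝ), (0 : ℝ)) p.1 :=
    (hasDerivAt_id p.1).prodMk (hasDerivAt_const p.1 p.2)
  exact hu.hasFDerivAt.comp_hasDerivAt p.1 h

variable {G : Type*} [TopologicalSpace G] [ChartedSpace E G] [Group G] [LieGroup 𝓘(ℝ, E) ∞ G]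
  {V : Type*} [NormedAddCommGroup V] [NormedSpace ℝ V]
  {γ : ℝ → ℝ → G} {U : Set (ℝ × ℝ)}

omit [Group G] [LieGroup 𝓘(ℝ, E) ∞ G] in
theorem mdifferentiableAt_right {p : ℝ × ℝ}
    (h : MDifferentiableAt 𝓘(ℝ, ℝ × ℝ) 𝓘(ℝ, E) (fun p : ℝ × ℝ => γ p.1 p.2) p) :
    MDifferentiableAt 𝓘(ℝ, ℝ) 𝓘(ℝ, E) (γ p.1) p.2 :=
  MDifferentiableAt.comp (I' := 𝓘(ℝ, ℝ × ℝ)) (f := fun t : ℝ => (p.1, t)) p.2 h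
    (((differentiableAt_const p.1).prodMk differentiableAt_id).mdifferentiableAt)

omit [Group G] [LieGroup 𝓘(ℝ, E) ∞ G] in
theorem mdifferentiableAt_left {p : ℝ × ℝ}
    (h : MDifferentiableAt 𝓘(ℝ, ℝ × ℝ) 𝓘(ℝ, E) (fun p : ℝ × ℝ => γ p.1 p.2) p) :
    MDifferentiableAt 𝓘(ℝ, ℝ) 𝓘(ℝ, E) (fun ε => γ ε p.2) p.1 :=
  MDifferentiableAt.comp (I' := 𝓘(ℝ, ℝ × ℝ)) (f := fun ε : ℝ => (ε, p.2)) p.1 h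
    ((differentiableAt_id.prodMk (differentiableAt_const p.2)).mdifferentiableAt)

/-- Both logarithmic derivatives of a smooth family, in a chart. -/
theorem exists_chart_bodyVelocity (hU : IsOpen U)
    (hγ : ContMDiffOn 𝓘(ℝ, ℝ × ℝ) 𝓘(ℝ, E) ∞ (fun p : ℝ × ℝ => γ p.1 p.2) U)
    {p₀ : ℝ × ℝ} (hp₀ : p₀ ∈ U) :
    ∃ e ∈ IsManifold.maximalAtlas 𝓘(ℝ, E) ∞ G, ∃ u : ℝ × ℝ → E, ContDiffAt ℝ ∞ u p₀ ∧
      u p₀ ∈ e.target ∧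
      (∀ᶠ p in 𝓝 p₀, bodyVelocity (γ p.1) p.2 = leftForm e (u p) (fderiv ℝ u p (0, 1))) ∧
      (∀ᶠ p in 𝓝 p₀,
        bodyVelocity (fun ε => γ ε p.2) p.1 = leftForm e (u p) (fderiv ℝ u p (1, 0))) := by
  have := isManifold_infty E G
  set e := chartAt E (γ p₀.1 p₀.2) with he_def
  have he : e ∈ IsManifold.maximalAtlas 𝓘(ℝ, E) ∞ G := IsManifold.chart_mem_maximalAtlas _
  have hsrc : γ p₀.1 p₀.2 ∈ e.source := mem_chart_source E _
  have hat : ∀ p ∈ U, ContMDiffAt 𝓘(ℝ, ℝ × ℝ) 𝓘(ℝ, E) ∞ (fun p : ℝ × ℝ => γ p.1 p.2) p :=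
    fun p hp => hγ.contMDiffAt (hU.mem_nhds hp)
  have hev : ∀ᶠ p in 𝓝 p₀, p ∈ U ∧ γ p.1 p.2 ∈ e.source :=
    (hU.eventually_mem hp₀).and
      ((hat p₀ hp₀).continuousAt.preimage_mem_nhds (e.open_source.mem_nhds hsrc))
  have hu : ∀ p, p ∈ U → γ p.1 p.2 ∈ e.source →
      ContDiffAt ℝ ∞ (fun p : ℝ × ℝ => e (γ p.1 p.2)) p := fun p hp hps => by
    rw [← contMDiffAt_iff_contDiffAt]
    exact ContMDiffAt.comp (I' := 𝓘(ℝ, E)) p (g := e) (f := fun p : ℝ × ℝ => γ p.1 p.2)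
      (contMDiffAt_of_mem_maximalAtlas he hps) (hat p hp)
  refine ⟨e, he, fun p => e (γ p.1 p.2), hu p₀ hp₀ hsrc, e.map_source hsrc, ?_, ?_⟩
  · filter_upwards [hev] with p hp
    rw [bodyVelocity_eq_leftForm he
      (mdifferentiableAt_right ((hat p hp.1).mdifferentiableAt (by simp))) hp.2,
      ← (hasDerivAt_partial_right ((hu p hp.1 hp.2).differentiableAt (by simp))).deriv]
  · filter_upwards [hev] with p hp
    rw [bodyVelocity_eq_leftForm he
      (mdifferentiableAt_left ((hat p hp.1).mdifferentiableAt (by simp))) hp.2,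
      ← (hasDerivAt_partial_left ((hu p hp.1 hp.2).differentiableAt (by simp))).deriv]

theorem contDiffOn_bodyVelocity_right (hU : IsOpen U)
    (hγ : ContMDiffOn 𝓘(ℝ, ℝ × ℝ) 𝓘(ℝ, E) ∞ (fun p : ℝ × ℝ => γ p.1 p.2) U) :
    ContDiffOn ℝ ∞ (fun p : ℝ × ℝ => bodyVelocity (E := E) (γ p.1) p.2) U := fun p hp => by
  obtain ⟨e, he, u, hu, hut, hX, -⟩ := exists_chart_bodyVelocity hU hγ hp
  refine ((ContDiffAt.clm_apply ?_ ?_).congr_of_eventuallyEq hX).contDiffWithinAt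
  · exact (contDiffAt_leftForm he hut).comp p hu
  · exact (hu.fderiv_right (m := ∞) (by simp)).clm_apply contDiffAt_const

theorem contDiffOn_bodyVelocity_left (hU : IsOpen U)
    (hγ : ContMDiffOn 𝓘(ℝ, ℝ × ℝ) 𝓘(ℝ, E) ∞ (fun p : ℝ × ℝ => γ p.1 p.2) U) :
    ContDiffOn ℝ ∞ (fun p : ℝ × ℝ => bodyVelocity (E := E) (fun ε => γ ε p.2) p.1) U :=
  fun p hp => by
  obtain ⟨e, he, u, hu, hut, -, hY⟩ := exists_chart_bodyVelocity hU hγ hp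
  refine ((ContDiffAt.clm_apply ?_ ?_).congr_of_eventuallyEq hY).contDiffWithinAt
  · exact (contDiffAt_leftForm he hut).comp p hu
  · exact (hu.fderiv_right (m := ∞) (by simp)).clm_apply contDiffAt_const

omit [LieGroup 𝓘(ℝ, E) ∞ G] in
theorem contDiffOn_advected {ρ : G →* (V →L[ℝ] V)}
    (hρ : ContMDiff 𝓘(ℝ, E) 𝓘(ℝ, V →L[ℝ] V) ∞ (fun x : G => ρ x)) (a₀ : StrongDual ℝ V)
    (hγ : ContMDiffOn 𝓘(ℝ, ℝ × ℝ) 𝓘(ℝ, E) ∞ (fun p : ℝ × ℝ => γ p.1 p.2) U) :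
    ContDiffOn ℝ ∞ (fun p : ℝ × ℝ => advected ρ a₀ (γ p.1) p.2) U := by
  have h1 : ContDiffOn ℝ ∞ (fun p : ℝ × ℝ => ρ (γ p.1 p.2)) U :=
    contMDiffOn_iff_contDiffOn.1 (hρ.comp_contMDiffOn hγ)
  have h2 := (ContinuousLinearMap.compL ℝ V V ℝ a₀).contDiff.comp_contDiffOn h1
  refine h2.congr fun p _ => ?_
  simp [advected, dualAction]

/-- The variation of the body velocity in a smooth family: `∂_ε ξ = ∂_t η + [ξ, η]`. -/
theorem hasDerivAt_bodyVelocity_family [CompleteSpace E] (hU : IsOpen U)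
    (hγ : ContMDiffOn 𝓘(ℝ, ℝ × ℝ) 𝓘(ℝ, E) ∞ (fun p : ℝ × ℝ => γ p.1 p.2) U)
    {ε₀ t₀ : ℝ} (hp : (ε₀, t₀) ∈ U) :
    HasDerivAt (fun ε => bodyVelocity (E := E) (γ ε) t₀)
      (deriv (fun t => bodyVelocity (E := E) (fun ε => γ ε t) ε₀) t₀ +
        bracket G (bodyVelocity (E := E) (γ ε₀) t₀)
          (bodyVelocity (E := E) (fun ε => γ ε t₀) ε₀)) ε₀ := by
  obtain ⟨e, he, u, hu, hut, hX, hY⟩ := exists_chart_bodyVelocity hU hγ hp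
  have hu1 : HasFDerivAt u _ (ε₀, t₀) := (hu.differentiableAt (by simp)).hasFDerivAt
  have hu2 := ((hu.fderiv_right (m := ∞) (by simp)).differentiableAt (by simp)).hasFDerivAt
  have hK := ((contDiffAt_leftForm he hut).differentiableAt (by simp)).hasFDerivAt
  have hform : ∀ w : ℝ × ℝ, HasFDerivAt (fun p => leftForm e (u p) (fderiv ℝ u p w)) _ (ε₀, t₀) :=
    fun w => (hK.comp (ε₀, t₀) hu1).clm_apply (hu2.clm_apply (hasFDerivAt_const w _))
  have hdX := hasDerivAt_partial_left ((hform (0, 1)).congr_of_eventuallyEq hX).differentiableAt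
  have hdY := hasDerivAt_partial_right ((hform (1, 0)).congr_of_eventuallyEq hY).differentiableAt
  rw [((hform (0, 1)).congr_of_eventuallyEq hX).fderiv] at hdX
  rw [((hform (1, 0)).congr_of_eventuallyEq hY).fderiv] at hdY
  refine hdX.congr_deriv ?_
  rw [hdY.deriv, hX.self_of_nhds, hY.self_of_nhds, ← fderiv_leftForm_sub he hut]
  -- The terms K(u) ∂_ε∂_t u and K(u) ∂_t∂_ε u cancel by symmetry. What remains is the left side of
  -- the Maurer–Cartan equation.
  have hsymm := (hu.isSymmSndFDerivAt (by
    rw [minSmoothness_of_isRCLikeNormedField]; exact WithTop.coe_le_coe.2 le_top)).eq (1, 0) (0, 1)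
  simp [hsymm]

end Families

/-! ### Differentiation under the integral and the fundamental lemma. -/

section Analysis

open MeasureTheory

/-- Differentiation under the integral sign over a compact interval. -/
theorem hasDerivAt_integral_of_contDiffOn {F : ℝ × ℝ → ℝ} {U : Set (ℝ × ℝ)} {t₁ t₂ : ℝ}
    (ht : t₁ ≤ t₂) (hU : IsOpen U) (hUt : {(0 : ℝ)} ×ˢ Icc t₁ t₂ ⊆ U) (hF : ContDiffOn ℝ 1 F U) :
    HasDerivAt (fun ε => ∫ t in t₁..t₂, F (ε, t)) (∫ t in t₁..t₂, fderiv ℝ F (0, t) (1, 0)) 0 := by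
  have hdiff : ∀ p ∈ U, DifferentiableAt ℝ F p := fun p hp =>
    (hF.contDiffAt (hU.mem_nhds hp)).differentiableAt (by simp)
  have hF' : ContinuousOn (fun p => fderiv ℝ F p (1, 0)) U :=
    (hF.continuousOn_fderiv_of_isOpen hU (by simp)).clm_apply continuousOn_const
  obtain ⟨M, hM⟩ := (isCompact_singleton.prod isCompact_Icc).exists_bound_of_continuousOn
    (hF'.mono hUt)
  have hU' : IsOpen (U ∩ (fun p => fderiv ℝ F p (1, 0)) ⁻¹' Metric.ball 0 (M + 1)) :=
    hF'.isOpen_inter_preimage hU Metric.isOpen_ball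
  -- The ε-derivative is at most M on the segment ε = 0. Compactness yields one neighbourhood of 0
  -- on which M + 1 dominates for all t.
  obtain ⟨s, v, hs, -, h0s, htv, hsv⟩ := generalized_tube_lemma isCompact_singleton isCompact_Icc
    hU' (s := {(0 : ℝ)}) (t := Icc t₁ t₂) fun p hp => ⟨hUt hp, by
      simpa using (hM p hp).trans_lt (lt_add_one M)⟩
  have hmem : ∀ ε ∈ s, ∀ t ∈ Icc t₁ t₂, (ε, t) ∈ U ∧ ‖fderiv ℝ F (ε, t) (1, 0)‖ < M + 1 :=
    fun ε hε t htI => by simpa using hsv (mk_mem_prod hε (htv htI))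
  have hsub : uIoc t₁ t₂ ⊆ Icc t₁ t₂ := by rw [uIoc_of_le ht]; exact Ioc_subset_Icc_self
  have hs0 : (0 : ℝ) ∈ s := h0s rfl
  have hcont : ∀ ε ∈ s, ContinuousOn (fun t => F (ε, t)) (Icc t₁ t₂) := fun ε hε =>
    hF.continuousOn.comp (by fun_prop) fun t htI => (hmem ε hε t htI).1
  have hcont' : ContinuousOn (fun t => fderiv ℝ F (0, t) (1, 0)) (Icc t₁ t₂) :=
    hF'.comp (f := fun t : ℝ => ((0 : ℝ), t)) (by fun_prop) fun t htI => (hmem 0 hs0 t htI).1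
  refine (intervalIntegral.hasDerivAt_integral_of_dominated_loc_of_deriv_le
    (F := fun ε t => F (ε, t)) (F' := fun ε t => fderiv ℝ F (ε, t) (1, 0))
    (bound := fun _ => M + 1) (hs.mem_nhds hs0) ?_ ?_ ?_ ?_ ?_ ?_).2
  · filter_upwards [hs.mem_nhds hs0] with ε hε
    exact ((hcont ε hε).mono hsub).aestronglyMeasurable measurableSet_uIoc
  · exact (by simpa [uIcc_of_le ht] using hcont 0 hs0 :
      ContinuousOn (fun t => F (0, t)) (uIcc t₁ t₂)).intervalIntegrable
  · exact (hcont'.mono hsub).aestronglyMeasurable measurableSet_uIoc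
  · exact .of_forall fun t htI ε hε => (hmem ε hε t (hsub htI)).2.le
  · exact intervalIntegrable_const
  · exact .of_forall fun t htI ε hε => hasDerivAt_partial_left (hdiff _ (hmem ε hε t (hsub htI)).1)

/-- The fundamental lemma of the calculus of variations, for a smooth integrand. -/
theorem eqOn_zero_of_integral_mul_eq_zero {r : ℝ → ℝ} {J : Set ℝ} {t₁ t₂ : ℝ} (ht : t₁ < t₂)
    (hJt : Icc t₁ t₂ ⊆ J) (hr : ContDiffOn ℝ ∞ r J)
    (h : ∀ φ : ℝ → ℝ, ContDiffOn ℝ ∞ φ J → φ t₁ = 0 → φ t₂ = 0 →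
      ∫ t in t₁..t₂, φ t * r t = 0) : ∀ t ∈ Icc t₁ t₂, r t = 0 := by
  have hrc : ContinuousOn r (Icc t₁ t₂) := hr.continuousOn.mono hJt
  have hIoo : EqOn r 0 (Ioo t₁ t₂) := by
    intro t htI
    by_contra hne
    -- Since r is itself smooth on J, it may enter the test function, so no bump function is needed:
    -- the integrand becomes (t − t₁)(t₂ − t) r².
    have h0 := h (fun t => (t - t₁) * (t₂ - t) * r t)
      (((contDiff_id.sub contDiff_const).mul (contDiff_const.sub contDiff_id)).contDiffOn.mul hr)
      (by simp) (by simp)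
    refine (ne_of_gt (intervalIntegral.integral_pos ht ?_ ?_ ⟨t, Ioo_subset_Icc_self htI, ?_⟩)) h0
    · fun_prop
    · intro s hs
      have h1 : 0 ≤ (s - t₁) * (t₂ - s) :=
        mul_nonneg (sub_nonneg.2 hs.1.le) (sub_nonneg.2 hs.2)
      rw [mul_assoc]
      exact mul_nonneg h1 (mul_self_nonneg _)
    · have h1 : 0 < (t - t₁) * (t₂ - t) := mul_pos (sub_pos.2 htI.1) (sub_pos.2 htI.2)
      rw [mul_assoc]
      exact mul_pos h1 (mul_self_pos.2 hne)
  intro t htI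
  refine hIoo.of_subset_closure hrc continuousOn_const Ioo_subset_Icc_self ?_ htI
  rw [closure_Ioo ht.ne]

end Analysis

/-! ### Boundedness of the Lie bracket. -/

section Bracket

variable {E : Type*} [NormedAddCommGroup E] [NormedSpace ℝ E] [CompleteSpace E]

variable (E) in
/-- The bracket of a Banach–Lie algebra is bounded and bilinear. -/
theorem exists_bracket_eq (G : Type*) [TopologicalSpace G] [ChartedSpace E G] [Group G]
    [LieGroup 𝓘(ℝ, E) ∞ G] :
    ∃ B : E →L[ℝ] E →L[ℝ] E, ∀ ξ η, bracket G ξ η = B ξ η := by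
  have := isManifold_infty E G
  have he : chartAt E (1 : G) ∈ IsManifold.maximalAtlas 𝓘(ℝ, E) ∞ G :=
    IsManifold.chart_mem_maximalAtlas _
  have hq := (chartAt E (1 : G)).map_source (mem_chart_source E (1 : G))
  obtain ⟨A, hA, -⟩ := leftForm_eq_inverse he hq
  set D := fderiv ℝ (leftForm (chartAt E (1 : G))) (chartAt E (1 : G) 1)
  set C : E →L[ℝ] E →L[ℝ] E := D.bilinearComp (A.symm : E →L[ℝ] E) (A.symm : E →L[ℝ] E)
  -- The Maurer–Cartan equation at the identity writes the bracket as the antisymmetrization of DK,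
  -- a bounded bilinear map.
  refine ⟨C.flip - C, fun ξ η => ?_⟩
  have h := fderiv_leftForm_sub he hq (A.symm ξ) (A.symm η)
  simp only [hA, ContinuousLinearEquiv.coe_coe, ContinuousLinearEquiv.apply_symm_apply] at h
  rw [← h]
  rfl

end Bracket

/-! ### The Euler–Poincaré defect and the first variation of the reduced action. -/

section FirstVariation

open MeasureTheory

variable {E : Type*} [NormedAddCommGroup E] [NormedSpace ℝ E]
  {V : Type*} [NormedAddCommGroup V] [NormedSpace ℝ V]
  {l : E → StrongDual ℝ V → ℝ}

theorem hasFDerivAt_uncurried (hl : ContDiff ℝ ∞ (fun p : E × StrongDual ℝ V => l p.1 p.2))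
    (ξ : E) (a : StrongDual ℝ V) :
    HasFDerivAt (fun p : E × StrongDual ℝ V => l p.1 p.2)
      ((derivXi l ξ a).coprod (derivA l ξ a)) (ξ, a) := by
  have h : HasFDerivAt (fun p : E × StrongDual ℝ V => l p.1 p.2) _ (ξ, a) :=
    (hl.differentiable (by simp) (ξ, a)).hasFDerivAt
  have h1 := (HasFDerivAt.comp (f := fun e => (e, a)) ξ h (hasFDerivAt_prodMk_left ξ a)).fderiv
  have h2 := (HasFDerivAt.comp (f := fun b => (ξ, b)) a h (hasFDerivAt_prodMk_right ξ a)).fderiv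
  change derivXi l ξ a = _ at h1
  change derivA l ξ a = _ at h2
  refine h.congr_fderiv ?_
  rw [h1, h2]
  ext p <;> simp

theorem contDiff_derivXi (hl : ContDiff ℝ ∞ (fun p : E × StrongDual ℝ V => l p.1 p.2)) :
    ContDiff ℝ ∞ (fun p : E × StrongDual ℝ V => derivXi l p.1 p.2) := by
  convert! (hl.fderiv_right (m := ∞) (by simp)).clm_comp
    (contDiff_const (c := ContinuousLinearMap.inl ℝ E (StrongDual ℝ V))) using 2 with p
  rw [(hasFDerivAt_uncurried hl p.1 p.2).fderiv, ContinuousLinearMap.coprod_comp_inl]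

theorem contDiff_derivA (hl : ContDiff ℝ ∞ (fun p : E × StrongDual ℝ V => l p.1 p.2)) :
    ContDiff ℝ ∞ (fun p : E × StrongDual ℝ V => derivA l p.1 p.2) := by
  convert! (hl.fderiv_right (m := ∞) (by simp)).clm_comp
    (contDiff_const (c := ContinuousLinearMap.inr ℝ E (StrongDual ℝ V))) using 2 with p
  rw [(hasFDerivAt_uncurried hl p.1 p.2).fderiv, ContinuousLinearMap.coprod_comp_inr]

variable {G : Type*} [TopologicalSpace G] [ChartedSpace E G] [Group G]

/-- The defect of the Euler–Poincaré equations along `(ξ, a)`, with `B` the bracket. -/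
noncomputable def residual (B : E →L[ℝ] E →L[ℝ] E) (ρ : G →* (V →L[ℝ] V))
    (l : E → StrongDual ℝ V → ℝ) (ξ : ℝ → E) (a : ℝ → StrongDual ℝ V) (t : ℝ) : StrongDual ℝ E :=
  deriv (fun s => derivXi l (ξ s) (a s)) t - (derivXi l (ξ t) (a t)).comp (B (ξ t)) -
    diamond ρ (derivA l (ξ t) (a t)) (a t)

variable {B : E →L[ℝ] E →L[ℝ] E} {ρ : G →* (V →L[ℝ] V)} {ξ : ℝ → E} {a : ℝ → StrongDual ℝ V}
  {J : Set ℝ} {t₁ t₂ : ℝ}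

theorem contDiffOn_momentum (hl : ContDiff ℝ ∞ (fun p : E × StrongDual ℝ V => l p.1 p.2))
    (hξ : ContDiffOn ℝ ∞ ξ J) (ha : ContDiffOn ℝ ∞ a J) :
    ContDiffOn ℝ ∞ (fun t => derivXi l (ξ t) (a t)) J :=
  (contDiff_derivXi hl).comp_contDiffOn (hξ.prodMk ha)

theorem contDiffOn_residual (hl : ContDiff ℝ ∞ (fun p : E × StrongDual ℝ V => l p.1 p.2))
    (hJ : IsOpen J) (hξ : ContDiffOn ℝ ∞ ξ J) (ha : ContDiffOn ℝ ∞ a J) :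
    ContDiffOn ℝ ∞ (residual B ρ l ξ a) J := by
  have hμ := contDiffOn_momentum hl hξ ha
  have hν : ContDiffOn ℝ ∞ (fun t => derivA l (ξ t) (a t)) J :=
    (contDiff_derivA hl).comp_contDiffOn (hξ.prodMk ha)
  refine ((hμ.deriv_of_isOpen hJ (m := ∞) (by simp)).sub
    (hμ.clm_comp (B.contDiff.comp_contDiffOn hξ))).sub (hν.clm_comp ?_)
  have h1 : ContDiffOn ℝ ∞ (fun t => ContinuousLinearMap.compL ℝ V V ℝ (a t)) J :=
    ha.continuousLinearMap_comp _
  exact h1.clm_comp contDiffOn_const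

/-- The momentum δl/δξ is smooth along the curve, so the differentiability demanded by the equations
is automatic. -/
theorem eulerPoincareEquations_iff_residual (hB : ∀ ξ η, bracket G ξ η = B ξ η)
    (hl : ContDiff ℝ ∞ (fun p : E × StrongDual ℝ V => l p.1 p.2))
    (hJ : IsOpen J) (hJt : Icc t₁ t₂ ⊆ J) (hξ : ContDiffOn ℝ ∞ ξ J) (ha : ContDiffOn ℝ ∞ a J) :
    EulerPoincareEquations ρ l t₁ t₂ ξ a ↔ ∀ t ∈ Icc t₁ t₂, residual B ρ l ξ a t = 0 := by
  refine forall₂_congr fun t ht => ⟨?_, fun h => ?_⟩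
  · rintro ⟨μ', hμ', h⟩
    ext η
    simp [residual, hμ'.deriv, h, coadjoint, hB]
  · refine ⟨_, (((contDiffOn_momentum hl hξ ha).contDiffAt
      (hJ.mem_nhds (hJt ht))).differentiableAt (by simp)).hasDerivAt, fun η => ?_⟩
    have h1 := DFunLike.congr_fun h η
    simp only [residual, sub_apply, ContinuousLinearMap.comp_apply, zero_apply] at h1
    rw [coadjoint, hB]
    linarith

/-- The first variation of `∫ l` along a constrained variation. -/
theorem hasDerivAt_integral_reduced (hB : ∀ ξ η, bracket G ξ η = B ξ η)
    (hl : ContDiff ℝ ∞ (fun p : E × StrongDual ℝ V => l p.1 p.2)) (ht : t₁ ≤ t₂)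
    (hJ : IsOpen J) (hJt : Icc t₁ t₂ ⊆ J) (hξ : ContDiffOn ℝ ∞ ξ J) (ha : ContDiffOn ℝ ∞ a J)
    {Ξ : ℝ → ℝ → E} {A : ℝ → ℝ → StrongDual ℝ V} {U : Set (ℝ × ℝ)} (hU : IsOpen U)
    (hUt : {(0 : ℝ)} ×ˢ Icc t₁ t₂ ⊆ U) (hΞ : ContDiffOn ℝ ∞ (fun p : ℝ × ℝ => Ξ p.1 p.2) U)
    (hA : ContDiffOn ℝ ∞ (fun p : ℝ × ℝ => A p.1 p.2) U)
    (h0 : ∀ t ∈ Icc t₁ t₂, Ξ 0 t = ξ t ∧ A 0 t = a t) {η : ℝ → E} {W : Set ℝ} (hW : IsOpen W)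
    (hWt : Icc t₁ t₂ ⊆ W) (hη : ContDiffOn ℝ ∞ η W) (hη₁ : η t₁ = 0) (hη₂ : η t₂ = 0)
    (hδ : ∀ t ∈ Icc t₁ t₂,
      HasDerivAt (fun ε => Ξ ε t) (deriv η t + bracket G (ξ t) (η t)) 0 ∧
      HasDerivAt (fun ε => A ε t) (-(lieDualAction ρ (η t) (a t))) 0) :
    HasDerivAt (fun ε => ∫ t in t₁..t₂, l (Ξ ε t) (A ε t))
      (-∫ t in t₁..t₂, residual B ρ l ξ a t (η t)) 0 := by
  have hF : ContDiffOn ℝ ∞ (fun p : ℝ × ℝ => l (Ξ p.1 p.2) (A p.1 p.2)) U :=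
    hl.comp_contDiffOn (hΞ.prodMk hA)
  have key := hasDerivAt_integral_of_contDiffOn ht hU hUt (hF.of_le (by simp))
  refine key.congr_deriv ?_
  have hμ := contDiffOn_momentum hl hξ ha
  have hμ' : ∀ t ∈ Icc t₁ t₂, HasDerivAt (fun s => derivXi l (ξ s) (a s))
      (deriv (fun s => derivXi l (ξ s) (a s)) t) t := fun t ht =>
    ((hμ.contDiffAt (hJ.mem_nhds (hJt ht))).differentiableAt (by simp)).hasDerivAt
  have hη' : ∀ t ∈ Icc t₁ t₂, HasDerivAt η (deriv η t) t := fun t ht =>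
    ((hη.contDiffAt (hW.mem_nhds (hWt ht))).differentiableAt (by simp)).hasDerivAt
  have hparts : ∀ t ∈ Icc t₁ t₂, HasDerivAt (fun s => derivXi l (ξ s) (a s) (η s))
      (deriv (fun s => derivXi l (ξ s) (a s)) t (η t) + derivXi l (ξ t) (a t) (deriv η t)) t :=
    fun t ht => (hμ' t ht).clm_apply (hη' t ht)
  have hcμ' := (hμ.continuousOn_deriv_of_isOpen hJ (by simp)).mono hJt
  have hcη' := (hη.continuousOn_deriv_of_isOpen hW (by simp)).mono hWt
  have hcη := hη.continuousOn.mono hWt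
  have hcμ := hμ.continuousOn.mono hJt
  have hcR := (contDiffOn_residual (B := B) (ρ := ρ) hl hJ hξ ha).continuousOn.mono hJt
  have hint1 : IntervalIntegrable (fun t => deriv (fun s => derivXi l (ξ s) (a s)) t (η t) +
      derivXi l (ξ t) (a t) (deriv η t)) volume t₁ t₂ := by
    refine ContinuousOn.intervalIntegrable ?_
    rw [uIcc_of_le ht]
    exact (hcμ'.clm_apply hcη).add (hcμ.clm_apply hcη')
  have hint2 : IntervalIntegrable (fun t => residual B ρ l ξ a t (η t)) volume t₁ t₂ := by
    refine ContinuousOn.intervalIntegrable ?_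
    rw [uIcc_of_le ht]
    exact hcR.clm_apply hcη
  have hzero := intervalIntegral.integral_eq_sub_of_hasDerivAt
    (by rw [uIcc_of_le ht]; exact hparts) hint1
  rw [hη₁, hη₂, map_zero, map_zero, sub_zero] at hzero
  -- The integrand is d/dt ⟨δl/δξ, η⟩ − ⟨R, η⟩, and the total derivative integrates to zero because
  -- η vanishes at the endpoints.
  refine Eq.trans ?_ ((intervalIntegral.integral_sub hint1 hint2).trans (by rw [hzero, zero_sub]))
  refine intervalIntegral.integral_congr fun t htI => ?_
  rw [uIcc_of_le ht] at htI
  have hd := hasDerivAt_partial_left (p := (0, t)) ((hF.contDiffAt (hU.mem_nhds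
    (hUt (mk_mem_prod rfl htI)))).differentiableAt (by simp))
  have hl0 := hasFDerivAt_uncurried hl (Ξ 0 t) (A 0 t)
  have hpair := (hδ t htI).1.prodMk (hδ t htI).2
  have hΞA := HasFDerivAt.comp_hasDerivAt (f := fun ε => (Ξ ε t, A ε t)) 0 hl0 hpair
  have := hd.unique hΞA
  simp only [this, (h0 t htI).1, (h0 t htI).2, residual, sub_apply,
    ContinuousLinearMap.comp_apply, diamond_apply, ← hB,
    ContinuousLinearMap.coprod_apply, map_add, map_neg]
  ring

end FirstVariation

/-! ### Variations in the group and the constrained variations they induce. -/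

section Variations

variable {E : Type*} [NormedAddCommGroup E] [NormedSpace ℝ E]
  {G : Type*} [TopologicalSpace G] [ChartedSpace E G] [Group G] [LieGroup 𝓘(ℝ, E) ∞ G]
  {V : Type*} [NormedAddCommGroup V] [NormedSpace ℝ V]

theorem bodyVelocity_eq_mfderiv {c : ℝ → G} {t : ℝ} (hc : MDifferentiableAt 𝓘(ℝ, ℝ) 𝓘(ℝ, E) c t) :
    bodyVelocity (E := E) c t =
      (mfderiv 𝓘(ℝ, ℝ) 𝓘(ℝ, E) (fun s => (c t)⁻¹ * c s) t : ℝ →L[ℝ] E) 1 := by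
  have h := (HasMFDerivAt.comp (I' := 𝓘(ℝ, E)) t
    ((mdifferentiable_mul_left (E := E) (c t)⁻¹) (c t)).hasMFDerivAt hc.hasMFDerivAt).mfderiv
  exact (congrArg (fun T : ℝ →L[ℝ] E => T 1) h).symm

/-- The factor x cancels in (x c(t))⁻¹ (x c(s)). For a variation g(t) h(ε, t) at fixed t, only h
contributes to η. -/
theorem bodyVelocity_mul_left {c : ℝ → G} {t : ℝ} (x : G)
    (hc : MDifferentiableAt 𝓘(ℝ, ℝ) 𝓘(ℝ, E) c t) :
    bodyVelocity (E := E) (fun s => x * c s) t = bodyVelocity (E := E) c t := by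
  have hxc : MDifferentiableAt 𝓘(ℝ, ℝ) 𝓘(ℝ, E) (fun s => x * c s) t :=
    MDifferentiableAt.comp (I' := 𝓘(ℝ, E)) t (mdifferentiable_mul_left x (c t)) hc
  have h : (fun s => (x * c t)⁻¹ * (x * c s)) = fun s => (c t)⁻¹ * c s := by
    funext s; group
  rw [bodyVelocity_eq_mfderiv hc]
  refine (bodyVelocity_eq_mfderiv hxc).trans ?_
  exact congrArg (fun f : ℝ → G => (mfderiv 𝓘(ℝ, ℝ) 𝓘(ℝ, E) f t : ℝ →L[ℝ] E) 1) h

theorem bodyVelocity_eq_zero_of_eventually_const {c : ℝ → G} {t : ℝ} {x : G}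
    (h : c =ᶠ[𝓝 t] fun _ => x) : bodyVelocity (E := E) c t = 0 := by
  have hc : MDifferentiableAt 𝓘(ℝ, ℝ) 𝓘(ℝ, E) c t :=
    mdifferentiableAt_const.congr_of_eventuallyEq h
  have h2 : (fun s => (c t)⁻¹ * c s) =ᶠ[𝓝 t] fun _ => (c t)⁻¹ * x := by
    filter_upwards [h] with s hs
    rw [hs]
  have h3 : HasMFDerivAt 𝓘(ℝ, ℝ) 𝓘(ℝ, E) (fun s => (c t)⁻¹ * c s) t (0 : ℝ →L[ℝ] E) :=
    (hasMFDerivAt_const ((c t)⁻¹ * x) t).congr_of_eventuallyEq h2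
  rw [bodyVelocity_eq_mfderiv hc]
  exact congrArg (fun T : ℝ →L[ℝ] E => T 1) h3.mfderiv

omit [LieGroup 𝓘(ℝ, E) ∞ G] in
/-- The body velocity only depends on the curve on a nondegenerate compact interval. -/
theorem bodyVelocity_congr_Icc {c d : ℝ → G} {t₁ t₂ t : ℝ} (ht : t₁ < t₂) (htI : t ∈ Icc t₁ t₂)
    (hc : MDifferentiableAt 𝓘(ℝ, ℝ) 𝓘(ℝ, E) c t) (hd : MDifferentiableAt 𝓘(ℝ, ℝ) 𝓘(ℝ, E) d t)
    (h : ∀ s ∈ Icc t₁ t₂, c s = d s) : bodyVelocity (E := E) c t = bodyVelocity (E := E) d t := by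
  -- The curves may differ outside the interval. At an endpoint, the one-sided derivative already
  -- determines the two-sided one.
  have hu : UniqueMDiffWithinAt 𝓘(ℝ, ℝ) (Icc t₁ t₂) t :=
    (uniqueDiffOn_Icc ht t htI).uniqueMDiffWithinAt
  have h2 : (mfderiv 𝓘(ℝ, ℝ) 𝓘(ℝ, E) c t : ℝ →L[ℝ] E) = mfderiv 𝓘(ℝ, ℝ) 𝓘(ℝ, E) d t :=
    (mfderivWithin_eq_mfderiv hu hc).symm.trans
      ((mfderivWithin_congr h (h t htI)).trans (mfderivWithin_eq_mfderiv hu hd))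
  have aux : ∀ (x y : G) (v w : E), x = y → v = w →
      (⟨x, v⟩ : TangentBundle 𝓘(ℝ, E) G) = ⟨y, w⟩ := by
    rintro x _ v _ rfl rfl
    rfl
  exact congrArg toLieAlgebra (aux _ _ _ _ (h t htI) (congrArg (fun T : ℝ →L[ℝ] E => T 1) h2))

variable {ρ : G →* (V →L[ℝ] V)} {t₁ t₂ : ℝ} {J : Set ℝ} {g : ℝ → G}

omit [Group G] [LieGroup 𝓘(ℝ, E) ∞ G] in
theorem contMDiffOn_const_family (hg : ContMDiffOn 𝓘(ℝ, ℝ) 𝓘(ℝ, E) ∞ g J) :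
    ContMDiffOn 𝓘(ℝ, ℝ × ℝ) 𝓘(ℝ, E) ∞ (fun p : ℝ × ℝ => g p.2) (univ ×ˢ J) :=
  hg.comp contDiff_snd.contMDiff.contMDiffOn fun _ hp => hp.2

theorem contDiffOn_bodyVelocity (hJ : IsOpen J) (hg : ContMDiffOn 𝓘(ℝ, ℝ) 𝓘(ℝ, E) ∞ g J) :
    ContDiffOn ℝ ∞ (bodyVelocity (E := E) g) J :=
  (contDiffOn_bodyVelocity_right (γ := fun _ => g) (isOpen_univ.prod hJ)
    (contMDiffOn_const_family hg)).comp (f := fun t : ℝ => ((0 : ℝ), t))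
    (contDiff_const.prodMk contDiff_id).contDiffOn fun _ ht => ⟨mem_univ _, ht⟩

omit [LieGroup 𝓘(ℝ, E) ∞ G] in
theorem contDiffOn_advected_curve
    (hρ : ContMDiff 𝓘(ℝ, E) 𝓘(ℝ, V →L[ℝ] V) ∞ (fun x : G => ρ x)) (a₀ : StrongDual ℝ V)
    (hg : ContMDiffOn 𝓘(ℝ, ℝ) 𝓘(ℝ, E) ∞ g J) : ContDiffOn ℝ ∞ (advected ρ a₀ g) J :=
  (contDiffOn_advected (γ := fun _ => g) hρ a₀
    (contMDiffOn_const_family hg)).comp (f := fun t : ℝ => ((0 : ℝ), t))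
    (contDiff_const.prodMk contDiff_id).contDiffOn fun _ ht => ⟨mem_univ _, ht⟩

/-- A variation of the curve induces a constrained variation of `(ξ, a)`, generated by
`η = γ⁻¹ ∂_ε γ`. -/
theorem IsVariation.infinitesimal_constraints [CompleteSpace E]
    (hρ : ContMDiff 𝓘(ℝ, E) 𝓘(ℝ, V →L[ℝ] V) ∞ (fun x : G => ρ x)) (a₀ : StrongDual ℝ V)
    (ht : t₁ < t₂) (hJ : IsOpen J) (hJt : Icc t₁ t₂ ⊆ J)
    (hg : ContMDiffOn 𝓘(ℝ, ℝ) 𝓘(ℝ, E) ∞ g J) {γ : ℝ → ℝ → G} (hγ : IsVariation E t₁ t₂ g γ) :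
    (∃ U : Set (ℝ × ℝ), IsOpen U ∧ {(0 : ℝ)} ×ˢ Icc t₁ t₂ ⊆ U ∧
      ContDiffOn ℝ ∞ (fun p : ℝ × ℝ => bodyVelocity (E := E) (γ p.1) p.2) U ∧
      ContDiffOn ℝ ∞ (fun p : ℝ × ℝ => advected ρ a₀ (γ p.1) p.2) U) ∧
    (∀ t ∈ Icc t₁ t₂, bodyVelocity (E := E) (γ 0) t = bodyVelocity (E := E) g t ∧
      advected ρ a₀ (γ 0) t = advected ρ a₀ g t) ∧
    (∃ W : Set ℝ, IsOpen W ∧ Icc t₁ t₂ ⊆ W ∧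
      ContDiffOn ℝ ∞ (fun t => bodyVelocity (E := E) (fun ε => γ ε t) 0) W) ∧
    bodyVelocity (E := E) (fun ε => γ ε t₁) 0 = 0 ∧
    bodyVelocity (E := E) (fun ε => γ ε t₂) 0 = 0 ∧
    ∀ t ∈ Icc t₁ t₂,
      HasDerivAt (fun ε => bodyVelocity (E := E) (γ ε) t)
        (deriv (fun t => bodyVelocity (E := E) (fun ε => γ ε t) 0) t +
          bracket G (bodyVelocity (E := E) g t) (bodyVelocity (E := E) (fun ε => γ ε t) 0)) 0 ∧
      HasDerivAt (fun ε => advected ρ a₀ (γ ε) t)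
        (-(lieDualAction ρ (bodyVelocity (E := E) (fun ε => γ ε t) 0) (advected ρ a₀ g t))) 0 := by
  obtain ⟨⟨U, hU, hUt, hγU⟩, hγ0, hγe⟩ := hγ
  have hmd : ∀ t ∈ Icc t₁ t₂,
      MDifferentiableAt 𝓘(ℝ, ℝ × ℝ) 𝓘(ℝ, E) (fun p : ℝ × ℝ => γ p.1 p.2) (0, t) := fun t htI =>
    (hγU.contMDiffAt (hU.mem_nhds (hUt (mk_mem_prod rfl htI)))).mdifferentiableAt (by simp)
  have h0 : ∀ t ∈ Icc t₁ t₂, bodyVelocity (E := E) (γ 0) t = bodyVelocity (E := E) g t ∧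
      advected ρ a₀ (γ 0) t = advected ρ a₀ g t := fun t htI =>
    ⟨bodyVelocity_congr_Icc ht htI (mdifferentiableAt_right (hmd t htI))
      ((hg.contMDiffAt (hJ.mem_nhds (hJt htI))).mdifferentiableAt (by simp)) hγ0, by
      simp only [advected, hγ0 t htI]⟩
  refine ⟨⟨U, hU, hUt, contDiffOn_bodyVelocity_right hU hγU, contDiffOn_advected hρ a₀ hγU⟩, h0,
    ⟨(fun t : ℝ => ((0 : ℝ), t)) ⁻¹' U, hU.preimage (by fun_prop),
      fun t htI => hUt (mk_mem_prod rfl htI),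
      (contDiffOn_bodyVelocity_left hU hγU).comp (f := fun t : ℝ => ((0 : ℝ), t))
        (contDiff_const.prodMk contDiff_id).contDiffOn fun _ ht => ht⟩,
    bodyVelocity_eq_zero_of_eventually_const (hγe.mono fun _ h => h.1),
    bodyVelocity_eq_zero_of_eventually_const (hγe.mono fun _ h => h.2), fun t htI => ⟨?_, ?_⟩⟩
  · rw [← (h0 t htI).1]
    exact hasDerivAt_bodyVelocity_family hU hγU (hUt (mk_mem_prod rfl htI))
  · rw [← (h0 t htI).2]
    exact hasDerivAt_advected hρ a₀ (mdifferentiableAt_left (p := (0, t)) (hmd t htI))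

theorem IsVariation.isConstrainedVariation [CompleteSpace E]
    (hρ : ContMDiff 𝓘(ℝ, E) 𝓘(ℝ, V →L[ℝ] V) ∞ (fun x : G => ρ x)) (a₀ : StrongDual ℝ V)
    (ht : t₁ < t₂) (hJ : IsOpen J) (hJt : Icc t₁ t₂ ⊆ J)
    (hg : ContMDiffOn 𝓘(ℝ, ℝ) 𝓘(ℝ, E) ∞ g J) {γ : ℝ → ℝ → G} (hγ : IsVariation E t₁ t₂ g γ) :
    IsConstrainedVariation ρ t₁ t₂ (bodyVelocity (E := E) g) (advected ρ a₀ g)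
      (fun ε => bodyVelocity (γ ε)) (fun ε => advected ρ a₀ (γ ε)) :=
  have h := hγ.infinitesimal_constraints hρ a₀ ht hJ hJt hg
  ⟨h.1, h.2.1, _, h.2.2⟩

/-- Every `φ(t) η₀` with `φ` vanishing at the endpoints generates a variation of the curve. -/
theorem exists_isVariation (hJ : IsOpen J) (hJt : Icc t₁ t₂ ⊆ J)
    (hg : ContMDiffOn 𝓘(ℝ, ℝ) 𝓘(ℝ, E) ∞ g J) {φ : ℝ → ℝ} (hφ : ContDiffOn ℝ ∞ φ J)
    (hφ₁ : φ t₁ = 0) (hφ₂ : φ t₂ = 0) (η₀ : E) :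
    ∃ γ : ℝ → ℝ → G, IsVariation E t₁ t₂ g γ ∧
      ∀ t ∈ Icc t₁ t₂, bodyVelocity (fun ε => γ ε t) 0 = φ t • η₀ := by
  have := isManifold_infty E G
  set e := chartAt E (1 : G)
  have he : e ∈ IsManifold.maximalAtlas 𝓘(ℝ, E) ∞ G := IsManifold.chart_mem_maximalAtlas _
  have hsrc : (1 : G) ∈ e.source := mem_chart_source E (1 : G)
  have hq := e.map_source hsrc
  obtain ⟨A, hA, -⟩ := leftForm_eq_inverse he hq
  -- A straight line in the chart at 1 replaces the exponential map; only its ε-derivative at 0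
  -- matters. The factor A⁻¹ = K(e 1)⁻¹ makes the generator exactly φ(t) η₀.
  set u : ℝ × ℝ → E := fun p => e 1 + p.1 • φ p.2 • A.symm η₀ with hu_def
  have hu : ContDiffOn ℝ ∞ u (univ ×ˢ J) :=
    contDiffOn_const.add (contDiff_fst.contDiffOn.smul
      ((hφ.comp contDiff_snd.contDiffOn fun _ hp => hp.2).smul contDiffOn_const))
  have hU : IsOpen ((univ ×ˢ J) ∩ u ⁻¹' e.target) :=
    hu.continuousOn.isOpen_inter_preimage (isOpen_univ.prod hJ) e.open_target
  have h1 : e.symm (e 1) = 1 := e.left_inv hsrc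
  refine ⟨fun ε t => g t * e.symm (u (ε, t)), ⟨⟨_, hU, ?_, ?_⟩, ?_, ?_⟩, ?_⟩
  · rintro ⟨ε, t⟩ ⟨hε, htI⟩
    obtain rfl : ε = 0 := hε
    exact ⟨⟨mem_univ _, hJt htI⟩, by simpa [hu_def] using hq⟩
  · refine ((contMDiffOn_const_family hg).mono inter_subset_left).mul ?_
    exact (contMDiffOn_symm_of_mem_maximalAtlas he).comp
      ((contMDiffOn_iff_contDiffOn.2 hu).mono inter_subset_left) fun _ hp => hp.2
  · intro t _
    simp [hu_def, h1]
  · exact .of_forall fun ε => by simp [hu_def, hφ₁, hφ₂, h1]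
  · intro t htI
    have hlin : HasDerivAt (fun ε => u (ε, t)) (φ t • A.symm η₀) 0 := by
      simpa [hu_def] using ((hasDerivAt_id (0 : ℝ)).smul_const (φ t • A.symm η₀)).const_add (e 1)
    have hu0 : u (0, t) = e 1 := by simp [hu_def]
    have hc : MDifferentiableAt 𝓘(ℝ, ℝ) 𝓘(ℝ, E) (fun ε => e.symm (u (ε, t))) 0 :=
      MDifferentiableAt.comp (I' := 𝓘(ℝ, E)) (0 : ℝ)
        (mdifferentiableAt_symm_of_mem_maximalAtlas he (by rw [hu0]; exact hq))
        hlin.differentiableAt.mdifferentiableAt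
    rw [bodyVelocity_mul_left _ hc, bodyVelocity_eq_leftForm he hc (by rw [hu0, h1]; exact hsrc),
      hu0, h1, hA]
    have hev : (fun ε => e (e.symm (u (ε, t)))) =ᶠ[𝓝 0] fun ε => u (ε, t) := by
      filter_upwards [hlin.continuousAt.preimage_mem_nhds
        (e.open_target.mem_nhds (by rw [hu0]; exact hq))] with ε hε
      exact e.right_inv hε
    rw [hev.deriv_eq, hlin.deriv]
    simp

end Variations

/-! ### The implications between the four conditions. -/

section Equivalence

open MeasureTheory

variable {E : Type*} [NormedAddCommGroup E] [NormedSpace ℝ E] [CompleteSpace E]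
  {G : Type*} [TopologicalSpace G] [ChartedSpace E G] [Group G] [LieGroup 𝓘(ℝ, E) ∞ G]
  {V : Type*} [NormedAddCommGroup V] [NormedSpace ℝ V]
  {ρ : G →* (V →L[ℝ] V)} {L : TangentBundle 𝓘(ℝ, E) G × StrongDual ℝ V → ℝ}
  {B : E →L[ℝ] E →L[ℝ] E} {J : Set ℝ} {g : ℝ → G} {t₁ t₂ : ℝ}

/-- The Euler–Lagrange expression in a chart is the Euler–Poincaré residual composed with the left
Maurer–Cartan form. -/
theorem hasDerivAt_fiberDerivative (hB : ∀ ξ η : E, bracket G ξ η = B ξ η)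
    (hρ : ContMDiff 𝓘(ℝ, E) 𝓘(ℝ, V →L[ℝ] V) ∞ (fun x : G => ρ x))
    (hL : ContMDiff (𝓘(ℝ, E).tangent.prod 𝓘(ℝ, StrongDual ℝ V)) 𝓘(ℝ, ℝ) ∞ L)
    (hinv : LeftInvariant ρ L) (a₀ : StrongDual ℝ V) (hJ : IsOpen J)
    (hg : ContMDiffOn 𝓘(ℝ, ℝ) 𝓘(ℝ, E) ∞ g J) {t : ℝ} (htJ : t ∈ J)
    {e : OpenPartialHomeomorph G E} (he : e ∈ IsManifold.maximalAtlas 𝓘(ℝ, E) ∞ G)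
    (hge : g t ∈ e.source) :
    HasDerivAt
      (fun s => fderiv ℝ (fun w => localLagrangian (fun v => L (v, a₀)) e (e (g s)) w)
        (deriv (fun r => e (g r)) s))
      (fderiv ℝ (fun q => localLagrangian (fun v => L (v, a₀)) e q (deriv (fun r => e (g r)) t))
          (e (g t)) +
        (residual B ρ (reduced L) (bodyVelocity g) (advected ρ a₀ g) t).comp
          (leftForm e (e (g t)))) t := by
  have hl := contDiff_reduced hL
  have hgat : ∀ s ∈ J, ContMDiffAt 𝓘(ℝ, ℝ) 𝓘(ℝ, E) ∞ g s := fun s hs =>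
    hg.contMDiffAt (hJ.mem_nhds hs)
  set q : ℝ → E := fun r => e (g r) with hq_def
  have hqt : q t ∈ e.target := e.map_source hge
  have hqs : ContDiffAt ℝ ∞ q t := by
    rw [← contMDiffAt_iff_contDiffAt]
    exact ContMDiffAt.comp (I' := 𝓘(ℝ, E)) t (g := e) (f := g)
      (contMDiffAt_of_mem_maximalAtlas he hge) (hgat t htJ)
  have hev : ∀ᶠ s in 𝓝 t, s ∈ J ∧ g s ∈ e.source :=
    (hJ.eventually_mem htJ).and
      ((hgat t htJ).continuousAt.preimage_mem_nhds (e.open_source.mem_nhds hge))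
  have hξ : ∀ s, s ∈ J → g s ∈ e.source →
      bodyVelocity g s = leftForm e (q s) (deriv q s) := fun s hs hse =>
    bodyVelocity_eq_leftForm he ((hgat s hs).mdifferentiableAt (by simp)) hse
  have ha : ∀ s, g s ∈ e.source → dualAction ρ (e.symm (q s))⁻¹ a₀ = advected ρ a₀ g s :=
    fun s hse => by simp only [hq_def, e.left_inv hse]; rfl
  set μ : ℝ → StrongDual ℝ E := fun s =>
    derivXi (reduced L) (bodyVelocity g s) (advected ρ a₀ g s) with hμ_def
  -- The velocity enters l only through the linear map K(q), hence ∂L/∂q̇ = μ ∘ K(q).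
  have hfib : (fun s => fderiv ℝ (fun w => localLagrangian (fun v => L (v, a₀)) e (q s) w)
      (deriv q s)) =ᶠ[𝓝 t] fun s => (μ s).comp (leftForm e (q s)) := by
    filter_upwards [hev] with s hs
    have hloc : (fun w => localLagrangian (fun v => L (v, a₀)) e (q s) w) =
        fun w => reduced L (leftForm e (q s) w) (advected ρ a₀ g s) := by
      funext w
      rw [localLagrangian_eq hinv a₀ he (e.map_source hs.2), ← ha s hs.2]
    have hd : DifferentiableAt ℝ (fun ζ => reduced L ζ (advected ρ a₀ g s))
        (leftForm e (q s) (deriv q s)) :=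
      (hl.comp (contDiff_prodMk_left (advected ρ a₀ g s))).differentiable (by simp) _
    rw [hloc, hμ_def]
    simp only [hξ s hs.1 hs.2]
    exact (hd.hasFDerivAt.comp (deriv q s) (leftForm e (q s)).hasFDerivAt).fderiv
  have hμ : HasDerivAt μ (deriv μ t) t :=
    (((contDiffOn_momentum hl (contDiffOn_bodyVelocity hJ hg)
      (contDiffOn_advected_curve hρ a₀ hg)).contDiffAt (hJ.mem_nhds htJ)).differentiableAt
        (by simp)).hasDerivAt
  have hK := ((contDiffAt_leftForm he hqt).differentiableAt (by simp)).hasFDerivAt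
  have hKq := hK.comp_hasDerivAt t (hqs.differentiableAt (by simp)).hasDerivAt
  refine ((hμ.clm_comp hKq).congr_of_eventuallyEq hfib).congr_deriv ?_
  have hl0 := hasFDerivAt_uncurried hl (leftForm e (q t) (deriv q t))
    (dualAction ρ (e.symm (q t))⁻¹ a₀)
  have hpair := (hK.clm_apply (hasFDerivAt_const (deriv q t) (q t))).prodMk
    (hasFDerivAt_dualAction_symm hρ a₀ he hqt)
  have hbase := (HasFDerivAt.comp (f := fun q' => (leftForm e q' (deriv q t),
    dualAction ρ (e.symm q')⁻¹ a₀)) (q t) hl0 hpair).congr_of_eventuallyEq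
    (f₁ := fun q' => localLagrangian (fun v => L (v, a₀)) e q' (deriv q t)) (by
      filter_upwards [e.open_target.mem_nhds hqt] with q' hq'
      exact localLagrangian_eq hinv a₀ he hq' _)
  rw [hbase.fderiv, ha t hge, ← hξ t htJ hge]
  ext w
  -- Differentiating μ ∘ K(q) in time gives μ(DK(q̇) w), while ∂L/∂q gives μ(DK(w) q̇). The
  -- Maurer–Cartan equation turns their difference into the ad* term at K(q) w.
  have hmc := fderiv_leftForm_sub he hqt (deriv q t) w
  rw [← hξ t htJ hge, hB, sub_eq_iff_eq_add] at hmc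
  simp [residual, hmc, diamond, hμ_def]
  ring

theorem eulerLagrange_iff_residual (hB : ∀ ξ η : E, bracket G ξ η = B ξ η)
    (hρ : ContMDiff 𝓘(ℝ, E) 𝓘(ℝ, V →L[ℝ] V) ∞ (fun x : G => ρ x))
    (hL : ContMDiff (𝓘(ℝ, E).tangent.prod 𝓘(ℝ, StrongDual ℝ V)) 𝓘(ℝ, ℝ) ∞ L)
    (hinv : LeftInvariant ρ L) (a₀ : StrongDual ℝ V) (hJ : IsOpen J) (hJt : Icc t₁ t₂ ⊆ J)
    (hg : ContMDiffOn 𝓘(ℝ, ℝ) 𝓘(ℝ, E) ∞ g J) :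
    EulerLagrange (fun v => L (v, a₀)) t₁ t₂ g ↔
      ∀ t ∈ Icc t₁ t₂, residual B ρ (reduced L) (bodyVelocity g) (advected ρ a₀ g) t = 0 := by
  have := isManifold_infty E G
  refine ⟨fun h t htI => ?_, fun h t htI e he hge => ?_⟩
  · have he : chartAt E (g t) ∈ IsManifold.maximalAtlas 𝓘(ℝ, E) ∞ G :=
      IsManifold.chart_mem_maximalAtlas _
    have hge := mem_chart_source E (g t)
    have h1 := (hasDerivAt_fiberDerivative hB hρ hL hinv a₀ hJ hg (hJt htI) he hge).unique
      (h t htI _ he hge)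
    rw [add_eq_left] at h1
    obtain ⟨A, hA, -⟩ := leftForm_eq_inverse he ((chartAt E (g t)).map_source hge)
    ext η
    have h2 := DFunLike.congr_fun h1 (A.symm η)
    simpa [hA] using h2
  · have h1 := hasDerivAt_fiberDerivative hB hρ hL hinv a₀ hJ hg (hJt htI) he hge
    rwa [h t htI, ContinuousLinearMap.zero_comp, add_zero] at h1

omit [CompleteSpace E] [LieGroup 𝓘(ℝ, E) ∞ G] in
/-- The action of an invariant Lagrangian in terms of the reduced Lagrangian. -/
theorem integral_velocity_eq_integral_reduced (hinv : LeftInvariant ρ L) (a₀ : StrongDual ℝ V)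
    (γ : ℝ → ℝ → G) :
    (fun ε => ∫ t in t₁..t₂, L (velocity (γ ε) t, a₀)) = fun ε => ∫ t in t₁..t₂,
      reduced L (bodyVelocity (γ ε) t) (advected ρ a₀ (γ ε) t) := by
  funext ε
  congr 1
  funext t
  exact (reduced_eq hinv (velocity (γ ε) t) a₀).symm

theorem residual_eq_zero_of_hamiltonPrinciple (hB : ∀ ξ η : E, bracket G ξ η = B ξ η)
    (hρ : ContMDiff 𝓘(ℝ, E) 𝓘(ℝ, V →L[ℝ] V) ∞ (fun x : G => ρ x))
    (hL : ContMDiff (𝓘(ℝ, E).tangent.prod 𝓘(ℝ, StrongDual ℝ V)) 𝓘(ℝ, ℝ) ∞ L)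
    (hinv : LeftInvariant ρ L) (a₀ : StrongDual ℝ V) (ht : t₁ < t₂) (hJ : IsOpen J)
    (hJt : Icc t₁ t₂ ⊆ J) (hg : ContMDiffOn 𝓘(ℝ, ℝ) 𝓘(ℝ, E) ∞ g J)
    (h : HamiltonPrinciple (fun v => L (v, a₀)) t₁ t₂ g) :
    ∀ t ∈ Icc t₁ t₂, residual B ρ (reduced L) (bodyVelocity g) (advected ρ a₀ g) t = 0 := by
  have hl := contDiff_reduced hL
  have hξ := contDiffOn_bodyVelocity hJ hg
  have ha := contDiffOn_advected_curve hρ a₀ hg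
  intro t htI
  ext η₀
  refine eqOn_zero_of_integral_mul_eq_zero
    (r := fun s => residual B ρ (reduced L) (bodyVelocity g) (advected ρ a₀ g) s η₀) ht hJt
    ((contDiffOn_residual hl hJ hξ ha).clm_apply contDiffOn_const)
    (fun φ hφ hφ₁ hφ₂ => ?_) t htI
  obtain ⟨γ, hγ, hγη⟩ := exists_isVariation hJ hJt hg hφ hφ₁ hφ₂ η₀
  obtain ⟨⟨U, hU, hUt, hΞ, hA⟩, h0, ⟨W, hW, hWt, hη⟩, hη₁, hη₂, hδ⟩ :=
    hγ.infinitesimal_constraints hρ a₀ ht hJ hJt hg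
  have h1 := hasDerivAt_integral_reduced hB hl ht.le hJ hJt hξ ha hU hUt hΞ hA h0 hW hWt hη hη₁
    hη₂ hδ
  have h2 := h γ hγ
  rw [integral_velocity_eq_integral_reduced hinv a₀ γ] at h2
  rw [← neg_eq_zero, ← h1.unique h2, neg_inj]
  refine intervalIntegral.integral_congr fun s hs => ?_
  rw [uIcc_of_le ht.le] at hs
  simp [hγη s hs]

omit [CompleteSpace E] [LieGroup 𝓘(ℝ, E) ∞ G] in
theorem constrainedPrinciple_of_residual_eq_zero (hB : ∀ ξ η : E, bracket G ξ η = B ξ η)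
    {l : E → StrongDual ℝ V → ℝ} (hl : ContDiff ℝ ∞ (fun p : E × StrongDual ℝ V => l p.1 p.2))
    {ξ : ℝ → E} {a : ℝ → StrongDual ℝ V} (ht : t₁ ≤ t₂) (hJ : IsOpen J) (hJt : Icc t₁ t₂ ⊆ J)
    (hξ : ContDiffOn ℝ ∞ ξ J) (ha : ContDiffOn ℝ ∞ a J)
    (h : ∀ t ∈ Icc t₁ t₂, residual B ρ l ξ a t = 0) : ConstrainedPrinciple ρ l t₁ t₂ ξ a := by
  rintro Ξ A ⟨⟨U, hU, hUt, hΞ, hA⟩, h0, η, ⟨W, hW, hWt, hη⟩, hη₁, hη₂, hδ⟩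
  refine (hasDerivAt_integral_reduced hB hl ht hJ hJt hξ ha hU hUt hΞ hA h0 hW hWt hη hη₁ hη₂
    hδ).congr_deriv ?_
  rw [neg_eq_zero]
  refine (intervalIntegral.integral_congr fun s hs => ?_).trans intervalIntegral.integral_zero
  rw [uIcc_of_le ht] at hs
  simp [h s hs]

theorem hamiltonPrinciple_of_constrainedPrinciple
    (hρ : ContMDiff 𝓘(ℝ, E) 𝓘(ℝ, V →L[ℝ] V) ∞ (fun x : G => ρ x))
    (hinv : LeftInvariant ρ L) (a₀ : StrongDual ℝ V) (ht : t₁ < t₂) (hJ : IsOpen J)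
    (hJt : Icc t₁ t₂ ⊆ J) (hg : ContMDiffOn 𝓘(ℝ, ℝ) 𝓘(ℝ, E) ∞ g J)
    (h : ConstrainedPrinciple ρ (reduced L) t₁ t₂ (bodyVelocity g) (advected ρ a₀ g)) :
    HamiltonPrinciple (fun v => L (v, a₀)) t₁ t₂ g := fun γ hγ => by
  rw [integral_velocity_eq_integral_reduced hinv a₀ γ]
  exact h _ _ (hγ.isConstrainedVariation hρ a₀ ht hJ hJt hg)

end Equivalence

end EulerPoincare

theorem theorem3p1
    {E : Type*} [NormedAddCommGroup E] [NormedSpace ℝ E] [CompleteSpace E]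
    {G : Type*} [TopologicalSpace G] [ChartedSpace E G] [Group G] [LieGroup 𝓘(ℝ, E) ∞ G]
    {V : Type*} [NormedAddCommGroup V] [NormedSpace ℝ V]
    (ρ : G →* (V →L[ℝ] V))
    (hρ : ContMDiff 𝓘(ℝ, E) 𝓘(ℝ, V →L[ℝ] V) ∞ (fun x : G => ρ x))
    (L : TangentBundle 𝓘(ℝ, E) G × StrongDual ℝ V → ℝ)
    (hL : ContMDiff (𝓘(ℝ, E).tangent.prod 𝓘(ℝ, StrongDual ℝ V)) 𝓘(ℝ, ℝ) ∞ L)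
    (hinv : EulerPoincare.LeftInvariant ρ L)
    (a₀ : StrongDual ℝ V)
    (t₁ t₂ : ℝ) (ht : t₁ < t₂)
    (J : Set ℝ) (hJ : IsOpen J) (hJt : Set.Icc t₁ t₂ ⊆ J)
    (g : ℝ → G) (hg : ContMDiffOn 𝓘(ℝ, ℝ) 𝓘(ℝ, E) ∞ g J) :
    List.TFAE [
      EulerPoincare.HamiltonPrinciple (fun v => L (v, a₀)) t₁ t₂ g,
      EulerPoincare.EulerLagrange (fun v => L (v, a₀)) t₁ t₂ g,
      EulerPoincare.ConstrainedPrinciple ρ (EulerPoincare.reduced L) t₁ t₂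
        (EulerPoincare.bodyVelocity g) (EulerPoincare.advected ρ a₀ g),
      EulerPoincare.EulerPoincareEquations ρ (EulerPoincare.reduced L) t₁ t₂
        (EulerPoincare.bodyVelocity g) (EulerPoincare.advected ρ a₀ g)] := by
  obtain ⟨B, hB⟩ := EulerPoincare.exists_bracket_eq E G
  have hl := EulerPoincare.contDiff_reduced hL
  have hξ := EulerPoincare.contDiffOn_bodyVelocity hJ hg
  have ha := EulerPoincare.contDiffOn_advected_curve hρ a₀ hg
  have hEP := EulerPoincare.eulerPoincareEquations_iff_residual (ρ := ρ) hB hl hJ hJt hξ ha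
  tfae_have 2 ↔ 4 := by
    rw [hEP]
    exact EulerPoincare.eulerLagrange_iff_residual hB hρ hL hinv a₀ hJ hJt hg
  -- The cycle (i) → (iv) → (iii) → (i) never requires lifting a constrained variation to a
  -- variation in G.
  tfae_have 1 → 4 := fun h => hEP.2
    (EulerPoincare.residual_eq_zero_of_hamiltonPrinciple hB hρ hL hinv a₀ ht hJ hJt hg h)
  tfae_have 4 → 3 := fun h =>
    EulerPoincare.constrainedPrinciple_of_residual_eq_zero hB hl ht.le hJ hJt hξ ha (hEP.1 h)
  tfae_have 3 → 1 :=
    EulerPoincare.hamiltonPrinciple_of_constrainedPrinciple hρ hinv a₀ ht hJ hJt hg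
  tfae_finish
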